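/- **Setting.** For $0\le\epsilon\le 1$ let $\omega$ be uniform on $\{-1,1\}^n$ and let $\omega^\epsilon$ arise from $\omega$ by flipping each coordinate independently with probability $\epsilon$. Let $h_n:\{-1,1\}^n\to\{-1,1\}$ and $T_n\in\{0,1,2,\dots\}$. Let $\theta_1,\dots,\theta_{T_n}$ be independent $n\times n$ matrices with i.i.d. $N(0,1)$ entries, independent of $(\omega,\omega^\epsilon)$; for $\omega_0\in\{-1,1\}^n$ put $\omega_t=\operatorname{sign}(\theta_t\omega_{t-1})$ coordinatewise, $t=1,\dots,T_n$, and $f_{n,T_n}(\omega_0)=h_n(\omega_{T_n})$. Let $\pi_n$ be the law of the random Boolean function $f_{n,T_n}$. **Definitions.** For a sequence of random Boolean functions $f_n$ with laws $\pi_n$, independent of $(\omega,\omega^\epsilon)$: * $\{f_n\}$ is *annealed QNS at level $\{\epsilon_n\}$* if $\mathrm{Cov}(f_n(\omega),f_n(\omega^{\epsilon_n}))\to 0$, the covariance being taken over $f_n,\omega,\omega^{\epsilon_n}$ jointly; it is *annealed noise sensitive* if for every fixed $0<\epsilon\le 1/2$ the joint covariance $\mathrm{Cov}(f_n(\omega),f_n(\omega^{\epsilon}))\to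 0$. * $\{f_n\}$ is *quenched QNS at level $\{\epsilon_n\}$* if for every $\delta>0$ there is $N$ such that for all $n\ge N$, $\pi_n\{f:\mathrm{Cov}_{\omega,\omega^{\epsilon_n}}(f(\omega),f(\omega^{\epsilon_n}))\le\delta\}\ge 1-\delta$. * $\{f_n\}$ is *annealed noise stable* if $\lim_{\epsilon\downarrow0}\sup_n \mathrm P(f_n(\omega)\ne f_n(\omega^\epsilon))=0$ (probability over $f_n,\omega,\omega^\epsilon$ jointly); it is *quenched noise stable* if for every $\delta>0$ there is $0<\epsilon\le1/2$ such that for all $n$, $\pi_n\{f:\mathrm P_{\omega,\omega^\epsilon}(f(\omega)\ne f(\omega^\epsilon))<\delta\}\ge1-\delta$. A deterministic sequence $\{h_n\}$ is *noise stable* if $\lim_{\epsilon\downarrow0}\sup_n\mathrm P(h_n(\omega)\ne h_n(\omega^\epsilon))=0$. **Theorem.** Let $\epsilon_n\le 1/2$ be non-increasing with $\epsilon_n\to0$ and $n\epsilon_n\to\infty$, and let $K_n$ be real numbers with $K_n/\log(1/\epsilon_n)\to\infty$. Then 1. if $b_n\to0$, $nb_n\to\infty$ and $K_n\le T_n\le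 e^{b_nn}$ for all large $n$, then for any Boolean functions $\{h_n\}$, $\{f_{n,T_n}\}$ is annealed QNS at level $\{\epsilon_n\}$; 2. if $h_n$ is odd (that is, $h_n(-\omega)=-h_n(\omega)$) for all $n\ge1$ and $T_n\ge K_n$ for all large $n$, then $\{f_{n,T_n}\}$ is annealed QNS at level $\{\epsilon_n\}$; 3. if $T_n\ge K_n$ for all large $n$, then for any $\{h_n\}$, $\{f_{n,T_n}\}$ is quenched QNS at level $\{\epsilon_n\}$. Moreover, independently of $\{\epsilon_n\}$ and $\{K_n\}$, 4. there are Boolean functions $\{h_n\}$ and integers $\{\tau_n\}$ such that, whenever $T_n\ge\tau_n$ for all large $n$, $\{f_{n,T_n}\}$ is not annealed noise sensitive; 5. if $\{h_n\}$ is noise stable and $T_n$ is bounded, then $\{f_{n,T_n}\}$ is annealed noise stable and quenched noise stable. -/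

import Mathlib

open Filter Topology MeasureTheory ProbabilityTheory

noncomputable section

namespace SignNetwork

/-- The Boolean cube `{-1, 1}^n`; the two-point set `{-1, 1}` is `ℤˣ`. -/
abbrev Cube (n : ℕ) : Type := Fin n → ℤˣ

/-- Boolean functions `{-1, 1}^n → {-1, 1}`. -/
abbrev BoolFun (n : ℕ) : Type := Cube n → ℤˣ

/-- The element `-1` or `1` of `{-1, 1}` as a real number. -/
def toReal (u : ℤˣ) : ℝ := ((u : ℤ) : ℝ)

instance : MeasurableSingletonClass ℤˣ :=
  ⟨fun u => ⟨{(u : ℤ)}, measurableSet_singleton _, by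
    ext v; simp only [Set.mem_preimage, Set.mem_singleton_iff]; exact Units.val_inj⟩⟩

/-! ### Input and noise -/

/-- The law on `{-1, 1}` giving mass `1 - ε` to `1` and mass `ε` to `-1` (for `0 ≤ ε ≤ 1`). -/
def flipLaw (ε : ℝ) : Measure ℤˣ :=
  ENNReal.ofReal (1 - ε) • Measure.dirac 1 + ENNReal.ofReal ε • Measure.dirac (-1)

/-- The joint law of `(ω, ω^ε)`: `ω` is uniform on the cube, and `ω^ε` arises from `ω` by
multiplying every coordinate, independently, by a sign that is `-1` with probability `ε`. -/
def noisePair (n : ℕ) (ε : ℝ) : Measure (Cube n × Cube n) :=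
  ((Measure.pi fun _ : Fin n => flipLaw (1 / 2)).prod (Measure.pi fun _ : Fin n => flipLaw ε)).map
    fun p => (p.1, p.1 * p.2)

/-! ### Noise sensitivity and noise stability

`h` is a deterministic sequence of Boolean functions, `π` a sequence of laws of random Boolean
functions. -/

/-- `lim_{ε ↓ 0} sup_n P(h_n(ω) ≠ h_n(ω^ε)) = 0`. -/
def NoiseStable (h : ∀ n, BoolFun n) : Prop :=
  Tendsto (fun ε : ℝ => ⨆ n, noisePair n ε {p | h n p.1 ≠ h n p.2}) (𝓝[>] 0) (𝓝 0)

/-- `Cov(f(ω), f(ω^ε))` for a fixed Boolean function `f`. -/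
def noiseCov {n : ℕ} (f : BoolFun n) (ε : ℝ) : ℝ :=
  cov[fun p : Cube n × Cube n => toReal (f p.1), fun p => toReal (f p.2); noisePair n ε]

/-- `Cov(f(ω), f(ω^ε))` where `f` has law `π` and is independent of `(ω, ω^ε)`, the covariance
being taken over `f`, `ω` and `ω^ε` together. -/
def annealedCov {n : ℕ} (π : Measure (BoolFun n)) (ε : ℝ) : ℝ :=
  cov[fun q : BoolFun n × Cube n × Cube n => toReal (q.1 q.2.1),
    fun q => toReal (q.1 q.2.2); π.prod (noisePair n ε)]

/-- Annealed quantitative noise sensitivity at level `ε`. -/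
def AnnealedQNS (π : ∀ n, Measure (BoolFun n)) (ε : ℕ → ℝ) : Prop :=
  Tendsto (fun n => annealedCov (π n) (ε n)) atTop (𝓝 0)

/-- Quenched quantitative noise sensitivity at level `ε`. -/
def QuenchedQNS (π : ∀ n, Measure (BoolFun n)) (ε : ℕ → ℝ) : Prop :=
  ∀ δ : ℝ, 0 < δ → ∃ N : ℕ, ∀ n ≥ N, 1 - δ ≤ (π n).real {f | noiseCov f (ε n) ≤ δ}

/-- Annealed noise sensitivity: the noise level `ε` is fixed as `n → ∞`. -/
def AnnealedNoiseSensitive (π : ∀ n, Measure (BoolFun n)) : Prop :=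
  ∀ ε : ℝ, 0 < ε → ε ≤ 1 / 2 → Tendsto (fun n => annealedCov (π n) ε) atTop (𝓝 0)

/-- Annealed noise stability. -/
def AnnealedNoiseStable (π : ∀ n, Measure (BoolFun n)) : Prop :=
  Tendsto (fun ε : ℝ => ⨆ n, ((π n).prod (noisePair n ε)) {q | q.1 q.2.1 ≠ q.1 q.2.2})
    (𝓝[>] 0) (𝓝 0)

/-- Quenched noise stability. -/
def QuenchedNoiseStable (π : ∀ n, Measure (BoolFun n)) : Prop :=
  ∀ δ : ℝ, 0 < δ → ∃ ε : ℝ, 0 < ε ∧ ε ≤ 1 / 2 ∧ ∀ n,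
    1 - δ ≤ (π n).real {f | (noisePair n ε).real {p | f p.1 ≠ f p.2} < δ}

/-! ### The network -/

/-- The sign activation. The value at `0` only matters on a null event of weights. -/
def sgn (x : ℝ) : ℤˣ := if 0 ≤ x then 1 else -1

/-- Weight matrices of a layer of width `n`; `θ i j` is the weight from node `j` to node `i`. -/
abbrev Weights (n : ℕ) : Type := Fin n → Fin n → ℝ

/-- One fully connected layer without bias: `ω ↦ sign(θ ω)`, coordinatewise. -/
def layer {n : ℕ} (θ : Weights n) (ω : Cube n) : Cube n :=
  fun i => sgn (∑ j, θ i j * toReal (ω j))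

/-- The state `ω_T` after `T` layers: `ω_0 = ω` and `ω_{t+1} = sign(θ_{t+1} ω_t)`.
The weight matrix `θ_{t+1}` is stored at index `t`. -/
def state {n : ℕ} : (T : ℕ) → (Fin T → Weights n) → Cube n → Cube n
  | 0, _, ω => ω
  | T + 1, θ, ω => layer (θ (Fin.last T)) (state T (fun t => θ t.castSucc) ω)

/-- The Boolean function `f(ω) = h(ω_T)` represented by the network. -/
def netFun {n : ℕ} (T : ℕ) (h : BoolFun n) (θ : Fin T → Weights n) : BoolFun n :=
  fun ω => h (state T θ ω)

/-- The law of one weight matrix with i.i.d. standard normal entries. -/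
def matrixLaw (n : ℕ) : Measure (Weights n) :=
  Measure.pi fun _ : Fin n => Measure.pi fun _ : Fin n => gaussianReal 0 1

/-- The law of `T` independent such weight matrices. -/
def weightLaw (n T : ℕ) : Measure (Fin T → Weights n) :=
  Measure.pi fun _ : Fin T => matrixLaw n

theorem measurable_state {n : ℕ} (T : ℕ) (ω : Cube n) :
    Measurable fun θ : Fin T → Weights n => state T θ ω := by
  induction T with
  | zero => exact measurable_const
  | succ T ih =>
    refine measurable_pi_lambda _ fun i =>
      (Measurable.ite measurableSet_Ici measurable_const measurable_const :
        Measurable sgn).comp ?_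
    refine Finset.measurable_sum _ fun j _ => Measurable.mul (by fun_prop) ?_
    refine (measurable_of_countable toReal).comp ((measurable_pi_apply j).comp ?_)
    exact ih.comp (measurable_pi_lambda _ fun t => measurable_pi_apply _)

/-- Measurability makes the image measure below the genuine law. -/
theorem measurable_netFun {n : ℕ} (T : ℕ) (h : BoolFun n) :
    Measurable (netFun T h : (Fin T → Weights n) → BoolFun n) :=
  measurable_pi_lambda _ fun ω => (measurable_of_countable h).comp (measurable_state T ω)

/-- The law of the random Boolean function `f_{n,T}` with output function `h`. -/
def netLaw {n : ℕ} (T : ℕ) (h : BoolFun n) : Measure (BoolFun n) :=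
  (weightLaw n T).map (netFun T h)

end SignNetwork

end

open SignNetwork

/-!
Let `D_t = ω_t * ω_t^ε` be the quotient of the two states. Conditionally on the first `t` layers,
the coordinates of the next pair of states are independent, and each is symmetric under a common
change of sign, so `ω_{t+1}` is uniform and independent of `D_{t+1}`. A coordinate of `D_{t+1}` is
`-1` when a Gaussian functional separates `ω_t` from `ω_t^ε`; for states at relative Hamming
distance `x`, hence at angle `arccos (1 - 2 x)`, this has probability
`φ(x) = arccos (1 - 2 x) / π`. So `D` is a Markov chain, and covariances of the network are averages
over `D_T` of the autocorrelation of the output function `h`.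

Since `φ(x) ≥ (2 / π) √x`, a small distance grows geometrically and reaches a constant within
`O(log (1 / ε))` layers; from there on `φ` contracts towards `1 / 2`, and by Parseval the covariance
is at most the mean of `|1 - 2 x|` over the chain. The chain leaves the contraction region with
probability exponentially small in `n` per layer, so this bound survives up to depth `exp (c n)`.

For any larger depth one compares with the chain started from a uniform quotient: the balanced
quotient at time `O(log (1 / ε))` can be replaced by a uniform one, so the law of `D_T` no longer
depends on `ε`. For odd `h` the limit vanishes by the symmetry `D ↦ -D`; the mean of the
(nonnegative) quenched covariance is a difference of two such averages, at `ε` and at `1 / 2`. The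
quotients `1` and `-1` are absorbing, so at enormous depth the chain coalesces, and an even balanced
`h` keeps covariance near `1`.

In the opposite direction `φ(x) ≤ √x`, so by Jensen the mean distance after `t` layers is at most
`ε ^ 2 ^ (-t)`, which is small uniformly in `n` when the depth is bounded.
-/

noncomputable section

namespace SignNetwork

/-! ### Planar Gaussian cones -/

theorem gaussianPDF_mul_gaussianPDF_polar (r θ : ℝ) :
    gaussianPDF 0 1 (r * Real.cos θ) * gaussianPDF 0 1 (r * Real.sin θ) =
      ENNReal.ofReal ((2 * Real.pi)⁻¹ * Real.exp (-r ^ 2 / 2)) := by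
  have hexp : -(r * Real.cos θ) ^ 2 / 2 + -(r * Real.sin θ) ^ 2 / 2 = -r ^ 2 / 2 := by
    linear_combination (-r ^ 2 / 2) * Real.sin_sq_add_cos_sq θ
  rw [gaussianPDF, gaussianPDF, ← ENNReal.ofReal_mul (gaussianPDFReal_nonneg _ _ _)]
  simp only [gaussianPDFReal, sub_zero, NNReal.coe_one, mul_one]
  rw [mul_mul_mul_comm, ← mul_inv, Real.mul_self_sqrt (by positivity), ← Real.exp_add, hexp]

theorem gaussianReal_prod_cone_eq_mul {S : Set (ℝ × ℝ)} (hS : MeasurableSet S)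
    (hcone : ∀ r θ : ℝ, 0 < r →
      ((r * Real.cos θ, r * Real.sin θ) ∈ S ↔ (Real.cos θ, Real.sin θ) ∈ S)) :
    ((gaussianReal 0 1).prod (gaussianReal 0 1)) S =
      (∫⁻ r in Set.Ioi (0 : ℝ), ENNReal.ofReal r *
        ENNReal.ofReal ((2 * Real.pi)⁻¹ * Real.exp (-r ^ 2 / 2))) *
        volume ({θ | (Real.cos θ, Real.sin θ) ∈ S} ∩ Set.Ioo (-Real.pi) Real.pi) := by
  set A : Set ℝ := {θ | (Real.cos θ, Real.sin θ) ∈ S}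
  have hA : MeasurableSet A := (by fun_prop : Measurable fun θ => (Real.cos θ, Real.sin θ)) hS
  have hvol : volume (A ∩ Set.Ioo (-Real.pi) Real.pi) =
      ∫⁻ θ in Set.Ioo (-Real.pi) Real.pi, A.indicator 1 θ := by
    rw [lintegral_indicator_one hA, Measure.restrict_apply hA]
  rw [gaussianReal_of_var_ne_zero 0 one_ne_zero,
    prod_withDensity (measurable_gaussianPDF 0 1) (measurable_gaussianPDF 0 1),
    withDensity_apply _ hS, ← lintegral_indicator hS, ← Measure.volume_eq_prod,
    ← lintegral_comp_polarCoord_symm, hvol, ← lintegral_prod_mul (by fun_prop)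
    (measurable_one.indicator hA).aemeasurable, Measure.prod_restrict, ← Measure.volume_eq_prod]
  refine setLIntegral_congr_fun (measurableSet_Ioi.prod measurableSet_Ioo) ?_
  rintro ⟨r, θ⟩ ⟨hr, -⟩
  simp only [polarCoord_symm_apply, smul_eq_mul]
  by_cases hθ : θ ∈ A
  · rw [Set.indicator_of_mem ((hcone r θ hr).2 hθ), Set.indicator_of_mem hθ,
      gaussianPDF_mul_gaussianPDF_polar, Pi.one_apply, mul_one]
  · rw [Set.indicator_of_notMem fun h => hθ ((hcone r θ hr).1 h), Set.indicator_of_notMem hθ,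
      mul_zero, mul_zero]

theorem gaussianReal_prod_cone {S : Set (ℝ × ℝ)} (hS : MeasurableSet S)
    (hcone : ∀ r θ : ℝ, 0 < r →
      ((r * Real.cos θ, r * Real.sin θ) ∈ S ↔ (Real.cos θ, Real.sin θ) ∈ S)) :
    ((gaussianReal 0 1).prod (gaussianReal 0 1)) S =
      volume ({θ | (Real.cos θ, Real.sin θ) ∈ S} ∩ Set.Ioo (-Real.pi) Real.pi) /
        ENNReal.ofReal (2 * Real.pi) := by
  have htotal := gaussianReal_prod_cone_eq_mul MeasurableSet.univ (by simp)
  simp only [measure_univ, Set.mem_univ, Set.ofPred_true, Set.univ_inter, Real.volume_Ioo,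
    sub_neg_eq_add, ← two_mul] at htotal
  rw [gaussianReal_prod_cone_eq_mul hS hcone, ENNReal.eq_inv_of_mul_eq_one_left htotal.symm,
    mul_comm, div_eq_mul_inv]

theorem abs_cos_lt_sin_iff {α θ : ℝ} (hα : α ∈ Set.Icc 0 (Real.pi / 2))
    (hθ : θ ∈ Set.Icc 0 Real.pi) :
    |Real.cos θ| < Real.sin α ↔ θ ∈ Set.Ioo (Real.pi / 2 - α) (Real.pi / 2 + α) := by
  obtain ⟨hα0, hα1⟩ := hα
  obtain ⟨hθ0, hθ1⟩ := hθ
  rw [abs_lt, ← Real.cos_pi_div_two_sub α, neg_lt, ← Real.cos_pi_sub θ,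
    Real.strictAntiOn_cos.lt_iff_gt ⟨hθ0, hθ1⟩ ⟨by linarith, by linarith⟩,
    Real.strictAntiOn_cos.lt_iff_gt ⟨by linarith, by linarith⟩ ⟨by linarith, by linarith⟩]
  constructor <;> rintro ⟨h, h'⟩ <;> constructor <;> linarith

theorem setOf_abs_cos_lt_sin_inter_Ioo {α : ℝ} (hα : α ∈ Set.Icc 0 (Real.pi / 2)) :
    {θ : ℝ | |Real.cos θ| < Real.sin α} ∩ Set.Ioo (-Real.pi) Real.pi =
      Set.Ioo (Real.pi / 2 - α) (Real.pi / 2 + α) ∪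
        Set.Ioo (-(Real.pi / 2) - α) (-(Real.pi / 2) + α) := by
  have hα1 := hα.2
  ext θ
  simp only [Set.mem_inter_iff, Set.mem_ofPred_eq, Set.mem_union]
  constructor
  · rintro ⟨hcos, hlo, hhi⟩
    rcases le_total 0 θ with h | h
    · exact Or.inl ((abs_cos_lt_sin_iff hα ⟨h, hhi.le⟩).1 hcos)
    · rw [← Real.cos_neg] at hcos
      obtain ⟨h1, h2⟩ := (abs_cos_lt_sin_iff hα ⟨by linarith, by linarith⟩).1 hcos
      exact Or.inr ⟨by linarith, by linarith⟩
  · rintro (⟨h1, h2⟩ | ⟨h1, h2⟩)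
    · exact ⟨(abs_cos_lt_sin_iff hα ⟨by linarith, by linarith⟩).2 ⟨h1, h2⟩,
        by linarith, by linarith⟩
    · rw [← Real.cos_neg]
      exact ⟨(abs_cos_lt_sin_iff hα ⟨by linarith, by linarith⟩).2 ⟨by linarith, by linarith⟩,
        by linarith, by linarith⟩

theorem volume_abs_cos_lt_sin {α : ℝ} (hα : α ∈ Set.Icc 0 (Real.pi / 2)) :
    volume ({θ : ℝ | |Real.cos θ| < Real.sin α} ∩ Set.Ioo (-Real.pi) Real.pi) =
      ENNReal.ofReal (4 * α) := by
  obtain ⟨hα0, hα1⟩ := id hα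
  have hdisj : Disjoint (Set.Ioo (Real.pi / 2 - α) (Real.pi / 2 + α))
      (Set.Ioo (-(Real.pi / 2) - α) (-(Real.pi / 2) + α)) :=
    Set.disjoint_left.2 fun x hx hx' => by linarith [hx.1, hx'.2]
  rw [setOf_abs_cos_lt_sin_inter_Ioo hα, measure_union hdisj measurableSet_Ioo, Real.volume_Ioo,
    Real.volume_Ioo, ← ENNReal.ofReal_add (by linarith) (by linarith)]
  congr 1
  ring

theorem cos_mul_abs_cos_lt_sin_mul_abs_sin_iff {α θ : ℝ} (hα : α ∈ Set.Icc 0 (Real.pi / 2)) :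
    Real.cos α * |Real.cos θ| < Real.sin α * |Real.sin θ| ↔ |Real.cos θ| < Real.sin α := by
  have hcos : 0 ≤ Real.cos α :=
    Real.cos_nonneg_of_mem_Icc ⟨by linarith [hα.1, Real.pi_pos], hα.2⟩
  have hsin : 0 ≤ Real.sin α :=
    Real.sin_nonneg_of_nonneg_of_le_pi hα.1 (by linarith [hα.2, Real.pi_pos])
  rw [← sq_lt_sq₀ (by positivity) (by positivity), ← sq_lt_sq₀ (abs_nonneg _) hsin,
    mul_pow, mul_pow, sq_abs, sq_abs, Real.cos_sq' α, Real.sin_sq θ]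
  constructor <;> intro h <;> linarith

theorem gaussianReal_prod_cos_mul_abs_lt {α : ℝ} (hα : α ∈ Set.Icc 0 (Real.pi / 2)) :
    ((gaussianReal 0 1).prod (gaussianReal 0 1))
      {z : ℝ × ℝ | Real.cos α * |z.1| < Real.sin α * |z.2|} =
      ENNReal.ofReal (2 * α / Real.pi) := by
  rw [gaussianReal_prod_cone (measurableSet_lt (by fun_prop) (by fun_prop))]
  · simp only [Set.mem_ofPred_eq, cos_mul_abs_cos_lt_sin_mul_abs_sin_iff hα]
    rw [volume_abs_cos_lt_sin hα, ← ENNReal.ofReal_div_of_pos (by positivity)]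
    congr 1
    field_simp
    ring
  · intro r θ hr
    simp only [Set.mem_ofPred_eq, abs_mul, abs_of_pos hr]
    rw [mul_left_comm, mul_left_comm (Real.sin α), mul_lt_mul_iff_right₀ hr]

/-! ### One layer acting on a pair of inputs -/

theorem toReal_one : toReal 1 = 1 := by simp [toReal]

theorem toReal_neg (u : ℤˣ) : toReal (-u) = -toReal u := by simp [toReal]

theorem toReal_mul (u v : ℤˣ) : toReal (u * v) = toReal u * toReal v := by simp [toReal]

theorem toReal_mul_self (u : ℤˣ) : toReal u * toReal u = 1 := by
  rw [← toReal_mul, Int.units_mul_self, toReal_one]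

/-- The law of the `n` weights entering a node. -/
def rowLaw (n : ℕ) : Measure (Fin n → ℝ) := Measure.pi fun _ => gaussianReal 0 1

instance (n : ℕ) : IsProbabilityMeasure (rowLaw n) := by unfold rowLaw; infer_instance

/-- The preactivation of a node with incoming weights `g` at the state `ω`. -/
def dot {n : ℕ} (ω : Cube n) (g : Fin n → ℝ) : ℝ := ∑ j, g j * toReal (ω j)

theorem measurable_dot {n : ℕ} (ω : Cube n) : Measurable (dot ω) := by
  unfold dot; fun_prop

theorem dot_neg {n : ℕ} (ω : Cube n) (g : Fin n → ℝ) : dot ω (-g) = -dot ω g := by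
  simp [dot]

theorem dot_mul_toReal {n : ℕ} (ω η : Cube n) (g : Fin n → ℝ) :
    dot η (fun i => g i * toReal (ω i)) = dot (ω * η) g := by
  simp only [dot, Pi.mul_apply, toReal_mul, mul_assoc]

theorem measurePreserving_rowLaw_mul_toReal {n : ℕ} (ω : Cube n) :
    MeasurePreserving (fun (g : Fin n → ℝ) i => g i * toReal (ω i)) (rowLaw n) (rowLaw n) := by
  refine measurePreserving_pi (f := fun i x => x * toReal (ω i)) _ _ fun i => ⟨by fun_prop, ?_⟩
  rw [gaussianReal_map_mul_const]
  congr 1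
  · exact mul_zero _
  · ext
    simp [sq, toReal_mul_self]

theorem measurePreserving_rowLaw_neg (n : ℕ) :
    MeasurePreserving (fun g => -g) (rowLaw n) (rowLaw n) :=
  measurePreserving_pi (f := fun _ x => -x) _ _ fun _ =>
    ⟨measurable_neg, by rw [gaussianReal_map_neg, neg_zero]⟩

theorem iIndepFun_eval_rowLaw (n : ℕ) : iIndepFun (fun i (g : Fin n → ℝ) => g i) (rowLaw n) :=
  iIndepFun_pi fun _ => aemeasurable_id

theorem rowLaw_map_finsetSum {n : ℕ} (s : Finset (Fin n)) :
    (rowLaw n).map (fun g => ∑ i ∈ s, g i) = gaussianReal 0 (s.card : NNReal) := by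
  induction s using Finset.cons_induction with
  | empty => simp
  | cons a s ha ih =>
    have hindep := iIndepFun_eval_rowLaw n
    have hsum := gaussianReal_add_gaussianReal_of_indepFun
      (hindep.indepFun_finsetSum_of_notMem (fun i => by fun_prop) ha).symm
      (measurePreserving_eval (fun _ => gaussianReal 0 1) a).map_eq
      (by simpa only [Finset.sum_fn] using ih)
    simp only [Finset.sum_cons, Finset.card_cons, Nat.cast_add, Nat.cast_one,
      add_comm _ (1 : NNReal)]
    convert hsum using 1
    · congr 1 with g; simp
    · simp

theorem rowLaw_map_finsetSum_compl_prodMk {n : ℕ} (s : Finset (Fin n)) :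
    (rowLaw n).map (fun g => (∑ i ∈ sᶜ, g i, ∑ i ∈ s, g i)) =
      (gaussianReal 0 (sᶜ.card : NNReal)).prod (gaussianReal 0 (s.card : NNReal)) := by
  have hindep := iIndepFun_eval_rowLaw n
  have hsums : IndepFun (fun g : Fin n → ℝ => ∑ i ∈ sᶜ, g i) (fun g => ∑ i ∈ s, g i)
      (rowLaw n) := by
    convert (hindep.indepFun_finset sᶜ s disjoint_compl_left fun i => by fun_prop).comp
      (φ := fun x : (sᶜ : Finset (Fin n)) → ℝ => ∑ i, x i) (ψ := fun x : s → ℝ => ∑ i, x i)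
      (by fun_prop) (by fun_prop) using 1 <;> ext g
    · simp [Finset.sum_attach sᶜ g]
    · simp [Finset.sum_attach s g]
  rw [(indepFun_iff_map_prod_eq_prod_map_map (by fun_prop) (by fun_prop)).1 hsums,
    rowLaw_map_finsetSum, rowLaw_map_finsetSum]

theorem rowLaw_map_dot {n : ℕ} (ω : Cube n) : (rowLaw n).map (dot ω) = gaussianReal 0 n := by
  have hsum := rowLaw_map_finsetSum (Finset.univ : Finset (Fin n))
  rwa [Finset.card_fin, ← (measurePreserving_rowLaw_mul_toReal ω).map_eq,
    Measure.map_map (by fun_prop) (by fun_prop)] at hsum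

theorem dot_ne_zero_ae {n : ℕ} (hn : 0 < n) (ω : Cube n) : ∀ᵐ g ∂rowLaw n, dot ω g ≠ 0 := by
  have : NullSingletonClass (gaussianReal 0 (n : NNReal)) :=
    nullSingletonClass_gaussianReal (by exact_mod_cast hn.ne')
  refine ae_of_ae_map (p := (· ≠ 0)) (measurable_dot ω).aemeasurable ?_
  rw [rowLaw_map_dot]
  simp [ae_iff]

theorem measurable_sgn : Measurable sgn :=
  Measurable.ite measurableSet_Ici measurable_const measurable_const

theorem sgn_neg {x : ℝ} (hx : x ≠ 0) : sgn (-x) = -sgn x := by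
  rcases lt_or_gt_of_ne hx with h | h <;> simp [sgn, h.le, h.not_ge]

theorem sgn_ne_sgn_iff {x y : ℝ} (hx : x ≠ 0) (hy : y ≠ 0) : sgn x ≠ sgn y ↔ x * y < 0 := by
  have hne : (1 : ℤˣ) ≠ -1 := by decide
  rw [mul_neg_iff]
  rcases lt_or_gt_of_ne hx with h | h <;> rcases lt_or_gt_of_ne hy with h' | h' <;>
    simp [sgn, h, h', h.not_ge, h'.not_ge, h.le, h'.le, h.not_gt, h'.not_gt, hne, hne.symm]

theorem sgn_add_ne_sgn_sub_iff {a b : ℝ} (hadd : a + b ≠ 0) (hsub : a - b ≠ 0) :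
    sgn (a + b) ≠ sgn (a - b) ↔ |a| < |b| := by
  rw [sgn_ne_sgn_iff hadd hsub, ← sq_sub_sq, sub_neg, sq_lt_sq]

/-- The set of coordinates equal to `-1`. -/
def negSet {n : ℕ} (D : Cube n) : Finset (Fin n) := Finset.univ.filter fun i => D i = -1

/-- The fraction of coordinates equal to `-1`: the relative Hamming distance of two points of the
cube with quotient `D`. For `n = 0` it is `0`. -/
def negFrac {n : ℕ} (D : Cube n) : ℝ := (negSet D).card / n

/-- The probability that the sign of a random Gaussian functional separates two points of the cube
at relative Hamming distance `x`: the points enclose the angle `arccos (1 - 2 x)`. -/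
def sepProb (x : ℝ) : ℝ := Real.arccos (1 - 2 * x) / Real.pi

theorem negFrac_mem_Icc {n : ℕ} (D : Cube n) : negFrac D ∈ Set.Icc (0 : ℝ) 1 := by
  refine ⟨by unfold negFrac; positivity, div_le_one_of_le₀ ?_ n.cast_nonneg⟩
  exact_mod_cast (Finset.card_le_univ _).trans_eq (Fintype.card_fin n)

theorem sepProb_mem_Icc (x : ℝ) : sepProb x ∈ Set.Icc (0 : ℝ) 1 :=
  ⟨div_nonneg (Real.arccos_nonneg _) Real.pi_pos.le,
    div_le_one_of_le₀ (Real.arccos_le_pi _) Real.pi_pos.le⟩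

theorem pi_mul_sepProb (x : ℝ) : Real.pi * sepProb x = Real.arccos (1 - 2 * x) :=
  mul_div_cancel₀ _ Real.pi_ne_zero

theorem sin_pi_mul_sepProb_div_two {x : ℝ} (hx : x ∈ Set.Icc (0 : ℝ) 1) :
    Real.sin (Real.pi * sepProb x / 2) = √x := by
  rw [pi_mul_sepProb, Real.sin_half_eq_sqrt (Real.arccos_nonneg _)
    (by linarith [Real.arccos_le_pi (1 - 2 * x), Real.pi_pos]),
    Real.cos_arccos (by linarith [hx.2]) (by linarith [hx.1])]
  congr 1
  ring

theorem cos_pi_mul_sepProb_div_two {x : ℝ} (hx : x ∈ Set.Icc (0 : ℝ) 1) :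
    Real.cos (Real.pi * sepProb x / 2) = √(1 - x) := by
  rw [pi_mul_sepProb, Real.cos_half (by linarith [Real.arccos_nonneg (1 - 2 * x), Real.pi_pos])
    (Real.arccos_le_pi _), Real.cos_arccos (by linarith [hx.2]) (by linarith [hx.1])]
  congr 1
  ring

theorem gaussianReal_zero_eq_map (v : NNReal) :
    gaussianReal 0 v = (gaussianReal 0 1).map (fun x => √v * x) := by
  rw [gaussianReal_map_const_mul, mul_zero]
  congr 1
  ext
  simp

theorem gaussianReal_prod_abs_lt {v w : NNReal} (hvw : 0 < v + w) :
    ((gaussianReal 0 v).prod (gaussianReal 0 w)) {z : ℝ × ℝ | |z.1| < |z.2|} =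
      ENNReal.ofReal (sepProb (w / (v + w))) := by
  have hsum : (0 : ℝ) < v + w := by exact_mod_cast hvw
  set x : ℝ := w / (v + w) with hx_def
  have hx : x ∈ Set.Icc (0 : ℝ) 1 :=
    ⟨by positivity, div_le_one_of_le₀ (by linarith [v.coe_nonneg]) hsum.le⟩
  have hα : Real.pi * sepProb x / 2 ∈ Set.Icc 0 (Real.pi / 2) := by
    obtain ⟨h0, h1⟩ := sepProb_mem_Icc x
    constructor <;> nlinarith [Real.pi_pos]
  have hv : √(v : ℝ) = √(v + w) * √(1 - x) := by
    rw [← Real.sqrt_mul hsum.le]; congr 1; rw [hx_def]; field_simp; ring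
  have hw : √(w : ℝ) = √(v + w) * √x := by
    rw [← Real.sqrt_mul hsum.le]; congr 1; rw [hx_def]; field_simp
  have hcone := gaussianReal_prod_cos_mul_abs_lt hα
  rw [sin_pi_mul_sepProb_div_two hx, cos_pi_mul_sepProb_div_two hx] at hcone
  rw [gaussianReal_zero_eq_map v, gaussianReal_zero_eq_map w,
    Measure.map_prod_map _ _ (by fun_prop) (by fun_prop),
    Measure.map_apply (by fun_prop) (measurableSet_lt (by fun_prop) (by fun_prop))]
  convert hcone using 2
  · ext z
    simp only [Set.mem_preimage, Set.mem_ofPred_eq, Prod.map, abs_mul,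
      abs_of_nonneg (Real.sqrt_nonneg _)]
    rw [hv, hw, mul_assoc, mul_assoc, mul_lt_mul_iff_right₀ (Real.sqrt_pos.2 hsum)]
  · field_simp

theorem dot_one_eq_add {n : ℕ} (D : Cube n) (g : Fin n → ℝ) :
    dot 1 g = ∑ i ∈ (negSet D)ᶜ, g i + ∑ i ∈ negSet D, g i := by
  simp only [dot, Pi.one_apply, toReal_one, mul_one]
  exact (Finset.sum_compl_add_sum _ _).symm

theorem dot_eq_sub {n : ℕ} (D : Cube n) (g : Fin n → ℝ) :
    dot D g = ∑ i ∈ (negSet D)ᶜ, g i - ∑ i ∈ negSet D, g i := by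
  rw [dot, ← Finset.sum_compl_add_sum (negSet D), sub_eq_add_neg, ← Finset.sum_neg_distrib]
  congr 1 <;> refine Finset.sum_congr rfl fun i hi => ?_
  · have hDi : D i = 1 := (Int.units_eq_one_or _).resolve_right (by simpa [negSet] using hi)
    rw [hDi, toReal_one, mul_one]
  · have hDi : D i = -1 := by simpa [negSet] using hi
    rw [hDi, toReal_neg, toReal_one, mul_neg_one]

theorem rowLaw_sgn_dot_one_ne {n : ℕ} (hn : 0 < n) (D : Cube n) :
    rowLaw n {g | sgn (dot 1 g) ≠ sgn (dot D g)} = ENNReal.ofReal (sepProb (negFrac D)) := by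
  have hcard : (negSet D)ᶜ.card + (negSet D).card = n := by
    rw [Finset.card_compl_add_card, Fintype.card_fin]
  have hgauss := gaussianReal_prod_abs_lt (v := (negSet D)ᶜ.card) (w := (negSet D).card)
    (by exact_mod_cast hcard.symm ▸ hn)
  rw [← rowLaw_map_finsetSum_compl_prodMk, Measure.map_apply (by fun_prop)
    (measurableSet_lt (by fun_prop) (by fun_prop))] at hgauss
  have hfrac : negFrac D = ((negSet D).card : NNReal) /
      (((negSet D)ᶜ.card : NNReal) + ((negSet D).card : NNReal) : ℝ) := by
    rw [negFrac, NNReal.coe_natCast, NNReal.coe_natCast, ← Nat.cast_add, hcard]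
  rw [hfrac, ← hgauss]
  refine measure_congr ?_
  filter_upwards [dot_ne_zero_ae hn 1, dot_ne_zero_ae hn D] with g h1 hD
  rw [dot_one_eq_add D] at h1
  rw [dot_eq_sub] at hD
  refine propext ?_
  change sgn (dot 1 g) ≠ sgn (dot D g) ↔ |∑ i ∈ (negSet D)ᶜ, g i| < |∑ i ∈ negSet D, g i|
  rw [dot_one_eq_add D, dot_eq_sub, sgn_add_ne_sgn_sub_iff h1 hD]

theorem cube_mul_mul_cancel_left {n : ℕ} (u D : Cube n) : u * (u * D) = D := by
  ext i; simp [← mul_assoc]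

theorem measurableSet_sgn_dot_ne {n : ℕ} (ω ω' : Cube n) :
    MeasurableSet {g | sgn (dot ω g) ≠ sgn (dot ω' g)} :=
  (measurableSet_eq_fun (measurable_sgn.comp (measurable_dot ω))
    (measurable_sgn.comp (measurable_dot ω'))).compl

theorem rowLaw_sgn_dot_ne {n : ℕ} (hn : 0 < n) (ω ω' : Cube n) :
    rowLaw n {g | sgn (dot ω g) ≠ sgn (dot ω' g)} =
      ENNReal.ofReal (sepProb (negFrac (ω * ω'))) := by
  rw [← rowLaw_sgn_dot_one_ne hn, ← (measurePreserving_rowLaw_mul_toReal ω).measure_preimage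
    (measurableSet_sgn_dot_ne 1 (ω * ω')).nullMeasurableSet]
  simp only [Set.preimage, Set.mem_ofPred_eq, dot_mul_toReal, mul_one, cube_mul_mul_cancel_left]

/-! ### Noisy pairs of inputs -/

instance (p : ℝ) : IsFiniteMeasure (flipLaw p) := by
  have := Measure.smul_finite (Measure.dirac (1 : ℤˣ)) (ENNReal.ofReal_ne_top (r := 1 - p))
  have := Measure.smul_finite (Measure.dirac (-1 : ℤˣ)) (ENNReal.ofReal_ne_top (r := p))
  unfold flipLaw; infer_instance

theorem flipLaw_real_one {p : ℝ} (hp : p ≤ 1) : (flipLaw p).real {1} = 1 - p := by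
  have hne : (-1 : ℤˣ) ∉ ({1} : Set ℤˣ) := by simp
  simp [flipLaw, Measure.real, hne, hp]

theorem flipLaw_real_neg_one {p : ℝ} (hp : 0 ≤ p) : (flipLaw p).real {-1} = p := by
  have hne : (1 : ℤˣ) ∉ ({-1} : Set ℤˣ) := by simp
  simp [flipLaw, Measure.real, hne, hp]

theorem isProbabilityMeasure_flipLaw {p : ℝ} (hp : p ∈ Set.Icc (0 : ℝ) 1) :
    IsProbabilityMeasure (flipLaw p) := by
  constructor
  simp only [flipLaw, Measure.add_apply, Measure.smul_apply, measure_univ, smul_eq_mul, mul_one]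
  rw [← ENNReal.ofReal_add (by linarith [hp.2]) hp.1, sub_add_cancel, ENNReal.ofReal_one]

/-- The joint law of a uniform sign and of a copy of it that is flipped with probability `p`. -/
def noisyBit (p : ℝ) : Measure (ℤˣ × ℤˣ) :=
  ((flipLaw (1 / 2)).prod (flipLaw p)).map fun q => (q.1, q.1 * q.2)

instance (p : ℝ) : IsFiniteMeasure (noisyBit p) := by unfold noisyBit; infer_instance

theorem noisyBit_real_singleton (p : ℝ) (u v : ℤˣ) :
    (noisyBit p).real {(u, v)} = (flipLaw (1 / 2)).real {u} * (flipLaw p).real {u * v} := by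
  have hpreimage : (fun q : ℤˣ × ℤˣ => (q.1, q.1 * q.2)) ⁻¹' {(u, v)} = {u} ×ˢ {u * v} := by
    ext ⟨a, b⟩
    simp only [Set.mem_preimage, Set.mem_singleton_iff, Prod.mk.injEq, Set.mem_prod]
    refine and_congr_right fun h => ?_
    rw [h, ← mul_right_inj u, ← mul_assoc, Int.units_mul_self, one_mul]
  rw [noisyBit, map_measureReal_apply (measurable_of_countable _) (measurableSet_singleton _),
    hpreimage, measureReal_prod_prod]

theorem measure_eq_noisyBit {μ : Measure (ℤˣ × ℤˣ)} [IsProbabilityMeasure μ]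
    (hneg : MeasurePreserving (fun q => -q) μ μ) : μ = noisyBit (μ.real {q | q.1 ≠ q.2}) := by
  set p := μ.real {q | q.1 ≠ q.2} with hp
  have hsymm (u v : ℤˣ) : μ.real {(-u, -v)} = μ.real {(u, v)} := by
    rw [← hneg.measureReal_preimage (measurableSet_singleton (u, v)).nullMeasurableSet]
    congr 1
    ext ⟨a, b⟩
    simp
  have hdiff : p = μ.real {(1, -1)} + μ.real {(-1, 1)} := by
    have hset : {q : ℤˣ × ℤˣ | q.1 ≠ q.2} = ↑({(1, -1), (-1, 1)} : Finset (ℤˣ × ℤˣ)) := by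
      ext q
      revert q
      decide
    rw [hp, hset, ← sum_measureReal_singleton, Finset.sum_pair (by decide)]
  have htotal : μ.real {(1, 1)} + μ.real {(1, -1)} +
      (μ.real {(-1, 1)} + μ.real {(-1, -1)}) = 1 := by
    have huniv : (Set.univ : Set (ℤˣ × ℤˣ)) = ↑(Finset.univ : Finset (ℤˣ × ℤˣ)) := by simp
    rw [← probReal_univ (μ := μ), huniv, ← sum_measureReal_singleton, Fintype.sum_prod_type]
    simp
  have h1 := hsymm 1 1
  have h2 := hsymm 1 (-1)
  rw [neg_neg] at h2
  have hp0 : 0 ≤ p := measureReal_nonneg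
  have hp1 : p ≤ 1 := measureReal_le_one
  refine Measure.ext_of_singleton fun ⟨u, v⟩ => ?_
  rw [← ENNReal.toReal_eq_toReal_iff' (measure_ne_top _ _) (measure_ne_top _ _)]
  change μ.real {(u, v)} = (noisyBit p).real {(u, v)}
  rw [noisyBit_real_singleton]
  rcases Int.units_eq_one_or u with rfl | rfl <;> rcases Int.units_eq_one_or v with rfl | rfl <;>
    simp only [one_mul, mul_one, neg_mul_neg, flipLaw_real_one one_half_lt_one.le,
      flipLaw_real_neg_one one_half_pos.le, flipLaw_real_one hp1, flipLaw_real_neg_one hp0] <;>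
    linarith

theorem measurable_sgn_dot_prodMk {n : ℕ} (ω ω' : Cube n) :
    Measurable fun g => (sgn (dot ω g), sgn (dot ω' g)) :=
  (measurable_sgn.comp (measurable_dot ω)).prodMk (measurable_sgn.comp (measurable_dot ω'))

theorem rowLaw_map_sgn_dot_prodMk {n : ℕ} (hn : 0 < n) (ω ω' : Cube n) :
    (rowLaw n).map (fun g => (sgn (dot ω g), sgn (dot ω' g))) =
      noisyBit (sepProb (negFrac (ω * ω'))) := by
  have hmeas := measurable_sgn_dot_prodMk ω ω'
  have := Measure.isProbabilityMeasure_map (μ := rowLaw n) hmeas.aemeasurable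
  rw [measure_eq_noisyBit (μ := (rowLaw n).map _)]
  · congr 1
    rw [map_measureReal_apply hmeas (Set.toFinite _).measurableSet, Measure.real]
    change (rowLaw n {g | sgn (dot ω g) ≠ sgn (dot ω' g)}).toReal = _
    rw [rowLaw_sgn_dot_ne hn, ENNReal.toReal_ofReal (sepProb_mem_Icc _).1]
  · refine ⟨measurable_of_countable _, ?_⟩
    rw [Measure.map_map (measurable_of_countable _) hmeas]
    conv_rhs => rw [← (measurePreserving_rowLaw_neg n).map_eq, Measure.map_map hmeas (by fun_prop)]
    refine Measure.map_congr ?_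
    filter_upwards [dot_ne_zero_ae hn ω, dot_ne_zero_ae hn ω'] with g h h'
    simp [dot_neg, sgn_neg h, sgn_neg h']

theorem noisePair_eq_map_pi (n : ℕ) (p : ℝ) :
    noisePair n p = (Measure.pi fun _ : Fin n => noisyBit p).map
      (MeasurableEquiv.arrowProdEquivProdArrow ℤˣ ℤˣ (Fin n)) := by
  have hpi : (Measure.pi fun _ : Fin n => noisyBit p) =
      (Measure.pi fun _ : Fin n => (flipLaw (1 / 2)).prod (flipLaw p)).map
        fun q i => ((q i).1, (q i).1 * (q i).2) :=
    (Measure.pi_map_pi (hμ := fun _ => (inferInstance : SigmaFinite (noisyBit p)))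
      fun _ => (measurable_of_countable _).aemeasurable).symm
  rw [noisePair, hpi, ← (measurePreserving_arrowProdEquivProdArrow ℤˣ ℤˣ (Fin n)
    (fun _ => flipLaw (1 / 2)) (fun _ => flipLaw p)).map_eq,
    Measure.map_map (measurable_of_countable _) (MeasurableEquiv.measurable _),
    Measure.map_map (MeasurableEquiv.measurable _) (measurable_of_countable _)]
  rfl

theorem measurable_layer {n : ℕ} (ω : Cube n) : Measurable fun θ : Weights n => layer θ ω :=
  measurable_pi_lambda _ fun i => measurable_sgn.comp (by fun_prop)

theorem matrixLaw_map_layer_prodMk {n : ℕ} (ω ω' : Cube n) :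
    (matrixLaw n).map (fun θ => (layer θ ω, layer θ ω')) =
      noisePair n (sepProb (negFrac (ω * ω'))) := by
  have hmeas := measurable_sgn_dot_prodMk ω ω'
  have hrows : (Measure.pi fun _ : Fin n => noisyBit (sepProb (negFrac (ω * ω')))) =
      (matrixLaw n).map fun θ i => (sgn (dot ω (θ i)), sgn (dot ω' (θ i))) := by
    have hrow : (fun _ : Fin n => noisyBit (sepProb (negFrac (ω * ω')))) =
        fun _ => (rowLaw n).map fun g => (sgn (dot ω g), sgn (dot ω' g)) :=
      funext fun i => (rowLaw_map_sgn_dot_prodMk i.pos ω ω').symm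
    have := Measure.isProbabilityMeasure_map (μ := rowLaw n) hmeas.aemeasurable
    rw [hrow]
    exact (Measure.pi_map_pi (μ := fun _ : Fin n => rowLaw n) fun _ => hmeas.aemeasurable).symm
  have hrows_meas : Measurable fun (θ : Weights n) i => (sgn (dot ω (θ i)), sgn (dot ω' (θ i))) :=
    measurable_pi_lambda _ fun i => hmeas.comp (measurable_pi_apply i)
  rw [noisePair_eq_map_pi, hrows, Measure.map_map (MeasurableEquiv.measurable _) hrows_meas]
  rfl

/-! ### The quotient chain -/

/-- The law of `n` independent signs, each `-1` with probability `p`. -/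
def flips (n : ℕ) (p : ℝ) : Measure (Cube n) := Measure.pi fun _ => flipLaw p

instance (n : ℕ) (p : ℝ) : IsFiniteMeasure (flips n p) := by unfold flips; infer_instance

theorem isProbabilityMeasure_flips (n : ℕ) {p : ℝ} (hp : p ∈ Set.Icc (0 : ℝ) 1) :
    IsProbabilityMeasure (flips n p) := by
  have := isProbabilityMeasure_flipLaw hp
  unfold flips; infer_instance

instance (n : ℕ) : IsProbabilityMeasure (flips n (1 / 2)) :=
  isProbabilityMeasure_flips n (by norm_num)

instance (n : ℕ) (x : ℝ) : IsProbabilityMeasure (flips n (sepProb x)) :=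
  isProbabilityMeasure_flips n (sepProb_mem_Icc x)

instance (n : ℕ) (p : ℝ) : IsFiniteMeasure (noisePair n p) := by unfold noisePair; infer_instance

theorem isProbabilityMeasure_noisePair (n : ℕ) {p : ℝ} (hp : p ∈ Set.Icc (0 : ℝ) 1) :
    IsProbabilityMeasure (noisePair n p) := by
  have := isProbabilityMeasure_flips n hp
  exact Measure.isProbabilityMeasure_map (μ := (flips n (1 / 2)).prod (flips n p))
    (measurable_of_countable _).aemeasurable

/-- The average of `G` over the pairs of points of the cube with quotient `D`. -/
def pairAvg {n : ℕ} (G : Cube n × Cube n → ℝ) (D : Cube n) : ℝ :=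
  ∫ u, G (u, u * D) ∂flips n (1 / 2)

theorem integral_noisePair {n : ℕ} (p : ℝ) (G : Cube n × Cube n → ℝ) :
    ∫ q, G q ∂noisePair n p = ∫ D, pairAvg G D ∂flips n p := by
  change ∫ q, G q ∂((flips n (1 / 2)).prod (flips n p)).map _ = _
  rw [integral_map (measurable_of_countable _).aemeasurable
    (measurable_of_countable _).aestronglyMeasurable, integral_prod_symm _ Integrable.of_finite]
  rfl

/-- The transition kernel of the quotient `ω_t * ω_t^ε` of the states of two inputs. -/
def quotKernel (n : ℕ) : Kernel (Cube n) (Cube n) :=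
  ⟨fun D => flips n (sepProb (negFrac D)), measurable_of_countable _⟩

instance (n : ℕ) : IsMarkovKernel (quotKernel n) :=
  ⟨fun _ => (inferInstance : IsProbabilityMeasure (flips n (sepProb _)))⟩

/-- The law of the quotient `ω_t * ω_t^p` of the states after `t` layers. -/
def quotLaw (n : ℕ) (p : ℝ) : ℕ → Measure (Cube n)
  | 0 => flips n p
  | t + 1 => quotKernel n ∘ₘ quotLaw n p t

instance (n : ℕ) (p : ℝ) (t : ℕ) : IsFiniteMeasure (quotLaw n p t) := by
  induction t with
  | zero => exact (inferInstance : IsFiniteMeasure (flips n p))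
  | succ t ih => unfold quotLaw; infer_instance

theorem isProbabilityMeasure_quotLaw (n : ℕ) {p : ℝ} (hp : p ∈ Set.Icc (0 : ℝ) 1) (t : ℕ) :
    IsProbabilityMeasure (quotLaw n p t) := by
  induction t with
  | zero => exact isProbabilityMeasure_flips n hp
  | succ t ih => unfold quotLaw; infer_instance

theorem integral_quotLaw_succ {n : ℕ} (p : ℝ) (t : ℕ) (g : Cube n → ℝ) :
    ∫ D, g D ∂quotLaw n p (t + 1) =
      ∫ D, ∫ E, g E ∂flips n (sepProb (negFrac D)) ∂quotLaw n p t :=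
  Kernel.integral_comp (κ := Kernel.const Unit (quotLaw n p t)) (η := quotKernel n) (a := ())
    Integrable.of_finite

theorem integral_quotLaw_add {n : ℕ} (p : ℝ) (m k : ℕ) (g : Cube n → ℝ) :
    ∫ D, g D ∂quotLaw n p (m + 1 + k) =
      ∫ D, ∫ E, g E ∂quotLaw n (sepProb (negFrac D)) k ∂quotLaw n p m := by
  induction k generalizing g with
  | zero => exact integral_quotLaw_succ p m g
  | succ k ih =>
    rw [← add_assoc, integral_quotLaw_succ, ih]
    simp only [← integral_quotLaw_succ]

/-! ### The network on a noisy pair of inputs -/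

instance (n : ℕ) : IsProbabilityMeasure (matrixLaw n) := by unfold matrixLaw; infer_instance

instance (n T : ℕ) : IsProbabilityMeasure (weightLaw n T) := by unfold weightLaw; infer_instance

instance {n : ℕ} (T : ℕ) (h : BoolFun n) : IsProbabilityMeasure (netLaw T h) :=
  Measure.isProbabilityMeasure_map (measurable_netFun T h).aemeasurable

theorem integral_layer_prodMk {n : ℕ} (ω ω' : Cube n) (G : Cube n × Cube n → ℝ) :
    ∫ θ, G (layer θ ω, layer θ ω') ∂matrixLaw n =
      ∫ r, G r ∂noisePair n (sepProb (negFrac (ω * ω'))) := by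
  rw [← matrixLaw_map_layer_prodMk, integral_map
    ((measurable_layer _).prodMk (measurable_layer _)).aemeasurable
    (measurable_of_countable _).aestronglyMeasurable]

theorem measurable_layer_state {n T : ℕ} (ω : Cube n) :
    Measurable fun z : Weights n × (Fin T → Weights n) => layer z.1 (state T z.2 ω) := by
  have hlayer : Measurable fun z : Weights n × Cube n => layer z.1 z.2 :=
    measurable_from_prod_countable_left measurable_layer
  exact hlayer.comp (measurable_fst.prodMk ((measurable_state T ω).comp measurable_snd))

theorem integral_weightLaw_succ {n T : ℕ} {F : Weights n × (Fin T → Weights n) → ℝ}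
    (hF : Integrable F ((matrixLaw n).prod (weightLaw n T))) :
    ∫ θ, F (θ (Fin.last T), fun t => θ t.castSucc) ∂weightLaw n (T + 1) =
      ∫ θ, ∫ θ', F (θ', θ) ∂matrixLaw n ∂weightLaw n T := by
  rw [← integral_prod_symm _ hF]
  refine Eq.trans ?_ ((measurePreserving_piFinSuccAbove (fun _ : Fin (T + 1) => matrixLaw n)
    (Fin.last T)).integral_comp (MeasurableEquiv.measurableEmbedding _) F)
  refine integral_congr_ae (Eventually.of_forall fun θ => ?_)
  simp only [MeasurableEquiv.piFinSuccAbove_apply, Fin.insertNthEquiv, Equiv.coe_fn_symm_mk]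
  congr 2
  funext t
  simp only [Fin.removeNth, Fin.succAbove_last]

theorem integral_state_succ {n : ℕ} (T : ℕ) (ω ω' : Cube n) (G : Cube n × Cube n → ℝ) :
    ∫ θ, G (state (T + 1) θ ω, state (T + 1) θ ω') ∂weightLaw n (T + 1) =
      ∫ θ, ∫ r, G r ∂noisePair n (sepProb (negFrac (state T θ ω * state T θ ω')))
        ∂weightLaw n T := by
  simp only [← integral_layer_prodMk]
  exact integral_weightLaw_succ (Integrable.comp_measurable (g := G) Integrable.of_finite
    ((measurable_layer_state ω).prodMk (measurable_layer_state ω')))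

theorem pairAvg_integral_noisePair {n : ℕ} (G : Cube n × Cube n → ℝ) (p : Cube n → ℝ)
    (D : Cube n) :
    pairAvg (fun q => ∫ r, G r ∂noisePair n (p (q.1 * q.2))) D =
      ∫ E, pairAvg G E ∂flips n (p D) := by
  simp only [pairAvg, cube_mul_mul_cancel_left, integral_const, probReal_univ, one_smul]
  exact integral_noisePair _ _

theorem integral_noisePair_state {n : ℕ} (p : ℝ) (T : ℕ) (G : Cube n × Cube n → ℝ) :
    ∫ q, ∫ θ, G (state T θ q.1, state T θ q.2) ∂weightLaw n T ∂noisePair n p =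
      ∫ D, pairAvg G D ∂quotLaw n p T := by
  induction T generalizing G with
  | zero => simp [state, quotLaw, integral_noisePair]
  | succ T ih =>
    simp only [integral_state_succ, integral_quotLaw_succ,
      ← pairAvg_integral_noisePair G fun D => sepProb (negFrac D)]
    exact ih fun q => ∫ r, G r ∂noisePair n (sepProb (negFrac (q.1 * q.2)))

theorem integral_netLaw_noisePair {n : ℕ} (p : ℝ) (T : ℕ) (h : BoolFun n) (G : ℤˣ × ℤˣ → ℝ) :
    ∫ f, ∫ q, G (f q.1, f q.2) ∂noisePair n p ∂netLaw T h =
      ∫ D, pairAvg (fun q => G (h q.1, h q.2)) D ∂quotLaw n p T := by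
  rw [integral_integral_swap Integrable.of_finite, ← integral_noisePair_state]
  refine integral_congr_ae (Eventually.of_forall fun q => ?_)
  exact integral_map (measurable_netFun T h).aemeasurable
    (measurable_of_countable _).aestronglyMeasurable

/-! ### Fourier analysis on the cube -/

theorem integral_flipLaw {p : ℝ} (hp : p ∈ Set.Icc (0 : ℝ) 1) (g : ℤˣ → ℝ) :
    ∫ u, g u ∂flipLaw p = (1 - p) * g 1 + p * g (-1) := by
  rw [integral_fintype Integrable.of_finite]
  simp [UnitsInt.univ, flipLaw_real_one hp.2, flipLaw_real_neg_one hp.1]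

theorem integral_prod_flips {n : ℕ} {p : ℝ} (hp : p ∈ Set.Icc (0 : ℝ) 1)
    (s : Finset (Fin n)) (g : ℤˣ → ℝ) :
    ∫ D, ∏ i ∈ s, g (D i) ∂flips n p = ((1 - p) * g 1 + p * g (-1)) ^ s.card := by
  classical
  have := isProbabilityMeasure_flipLaw hp
  have hfactors := integral_fintype_prod_eq_prod (μ := fun _ : Fin n => flipLaw p)
    fun i u => if i ∈ s then g u else 1
  simp only [Finset.prod_ite_mem, Finset.univ_inter] at hfactors
  rw [flips, hfactors, ← Finset.prod_const, ← Finset.prod_subset (Finset.subset_univ s)]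
  · refine Finset.prod_congr rfl fun i hi => ?_
    simp only [hi, if_true, integral_flipLaw hp]
  · intro i _ hi
    simp [hi]

theorem flips_real_singleton {n : ℕ} (p : ℝ) (u : Cube n) :
    (flips n p).real {u} = ∏ i, (flipLaw p).real {u i} := by
  rw [Measure.real, flips, Measure.pi_singleton, ENNReal.toReal_prod]
  rfl

theorem flips_half_real_singleton {n : ℕ} (u : Cube n) :
    (flips n (1 / 2)).real {u} = (2 ^ n : ℝ)⁻¹ := by
  have hbit (v : ℤˣ) : (flipLaw (1 / 2)).real {v} = 2⁻¹ := by
    rcases Int.units_eq_one_or v with rfl | rfl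
    · rw [flipLaw_real_one (by norm_num)]; norm_num
    · rw [flipLaw_real_neg_one (by norm_num)]; norm_num
  simp only [flips_real_singleton, hbit, Finset.prod_const, Finset.card_univ, Fintype.card_fin,
    inv_pow]

theorem integral_flips_half {n : ℕ} (g : Cube n → ℝ) :
    ∫ u, g u ∂flips n (1 / 2) = (2 ^ n : ℝ)⁻¹ * ∑ u, g u := by
  rw [integral_fintype Integrable.of_finite, Finset.mul_sum]
  simp only [flips_half_real_singleton, smul_eq_mul]

/-- The Walsh character of the cube indexed by `S`. -/
def walshChar {n : ℕ} (S : Finset (Fin n)) (D : Cube n) : ℝ := ∏ i ∈ S, toReal (D i)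

theorem walshChar_mul {n : ℕ} (S : Finset (Fin n)) (D E : Cube n) :
    walshChar S (D * E) = walshChar S D * walshChar S E := by
  simp [walshChar, toReal_mul, Finset.prod_mul_distrib]

theorem integral_walshChar {n : ℕ} {p : ℝ} (hp : p ∈ Set.Icc (0 : ℝ) 1) (S : Finset (Fin n)) :
    ∫ D, walshChar S D ∂flips n p = (1 - 2 * p) ^ S.card := by
  rw [show 1 - 2 * p = (1 - p) * toReal 1 + p * toReal (-1) by rw [toReal_neg, toReal_one]; ring]
  exact integral_prod_flips hp S toReal

theorem sum_walshChar_mul_walshChar {n : ℕ} (u v : Cube n) :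
    ∑ S, walshChar S u * walshChar S v = if u = v then (2 ^ n : ℝ) else 0 := by
  have hprod : ∑ S, walshChar S u * walshChar S v = ∏ i, (1 + toReal (u i * v i)) := by
    rw [Finset.prod_one_add, Finset.powerset_univ]
    simp only [walshChar, toReal_mul, Finset.prod_mul_distrib]
  rw [hprod]
  split_ifs with huv
  · subst huv
    simp only [toReal_mul, toReal_mul_self]
    norm_num
  · obtain ⟨i, hi⟩ := Function.ne_iff.1 huv
    refine Finset.prod_eq_zero (Finset.mem_univ i) ?_
    have hflip : u i * v i = -1 := by
      rw [Int.units_ne_iff_eq_neg.1 hi, neg_mul, Int.units_mul_self]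
    rw [hflip, toReal_neg, toReal_one, add_neg_cancel]

/-- The Fourier coefficient at `S` of a real function on the cube. -/
def walshCoeff {n : ℕ} (g : Cube n → ℝ) (S : Finset (Fin n)) : ℝ :=
  ∫ u, g u * walshChar S u ∂flips n (1 / 2)

theorem sum_walshCoeff_mul_walshChar {n : ℕ} (g : Cube n → ℝ) (v : Cube n) :
    ∑ S, walshCoeff g S * walshChar S v = g v := by
  simp only [walshCoeff, ← integral_mul_const]
  rw [← integral_finsetSum _ fun _ _ => Integrable.of_finite]
  simp only [mul_assoc, ← Finset.mul_sum, sum_walshChar_mul_walshChar, integral_flips_half]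
  simp [mul_comm (g v)]

/-- The autocorrelation `D ↦ E[g(u) g(u D)]`, for uniform `u`, of a real function on the cube. -/
def autocorr {n : ℕ} (g : Cube n → ℝ) : Cube n → ℝ := pairAvg fun q => g q.1 * g q.2

theorem autocorr_eq_sum {n : ℕ} (g : Cube n → ℝ) (D : Cube n) :
    autocorr g D = ∑ S, walshCoeff g S ^ 2 * walshChar S D := by
  have hexpand (u : Cube n) :
      g u * g (u * D) = ∑ S, walshCoeff g S * walshChar S D * (g u * walshChar S u) := by
    conv_lhs => rw [← sum_walshCoeff_mul_walshChar g (u * D), Finset.mul_sum]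
    refine Finset.sum_congr rfl fun S _ => ?_
    rw [walshChar_mul]
    ring
  simp only [autocorr, pairAvg, hexpand]
  rw [integral_finsetSum _ fun _ _ => Integrable.of_finite]
  refine Finset.sum_congr rfl fun S _ => ?_
  rw [integral_const_mul, ← walshCoeff]
  ring

theorem sum_walshCoeff_sq {n : ℕ} (g : Cube n → ℝ) :
    ∑ S, walshCoeff g S ^ 2 = autocorr g 1 := by
  simp [autocorr_eq_sum, walshChar, toReal_one]

theorem integral_autocorr {n : ℕ} {p : ℝ} (hp : p ∈ Set.Icc (0 : ℝ) 1) (g : Cube n → ℝ) :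
    ∫ D, autocorr g D ∂flips n p = ∑ S, walshCoeff g S ^ 2 * (1 - 2 * p) ^ S.card := by
  simp only [autocorr_eq_sum]
  rw [integral_finsetSum _ fun _ _ => Integrable.of_finite]
  simp only [integral_const_mul, integral_walshChar hp]

theorem integral_autocorr_half {n : ℕ} (g : Cube n → ℝ) :
    ∫ D, autocorr g D ∂flips n (1 / 2) = (∫ u, g u ∂flips n (1 / 2)) ^ 2 := by
  rw [integral_autocorr (by norm_num), Finset.sum_eq_single ∅]
  · simp [walshCoeff, walshChar]
  · intro S _ hS
    rw [show (1 - 2 * (1 / 2) : ℝ) = 0 by norm_num, zero_pow (by simpa using hS), mul_zero]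
  · simp

theorem integral_autocorr_sub {n : ℕ} {p : ℝ} (hp : p ∈ Set.Icc (0 : ℝ) 1) (g : Cube n → ℝ) :
    ∫ D, autocorr g D ∂flips n p - ∫ D, autocorr g D ∂flips n (1 / 2) =
      ∑ S ∈ Finset.univ.erase ∅, walshCoeff g S ^ 2 * (1 - 2 * p) ^ S.card := by
  rw [integral_autocorr_half, integral_autocorr hp,
    ← Finset.add_sum_erase _ _ (Finset.mem_univ ∅)]
  simp [walshCoeff, walshChar]

theorem abs_integral_autocorr_sub_le {n : ℕ} {p : ℝ} (hp : p ∈ Set.Icc (0 : ℝ) 1)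
    (g : Cube n → ℝ) :
    |∫ D, autocorr g D ∂flips n p - ∫ D, autocorr g D ∂flips n (1 / 2)| ≤
      autocorr g 1 * |1 - 2 * p| := by
  have hle : |1 - 2 * p| ≤ 1 := abs_le.2 ⟨by linarith [hp.2], by linarith [hp.1]⟩
  rw [integral_autocorr_sub hp, ← sum_walshCoeff_sq, Finset.sum_mul]
  calc _ ≤ ∑ S ∈ Finset.univ.erase (∅ : Finset (Fin n)), walshCoeff g S ^ 2 * |1 - 2 * p| := by
        refine (Finset.abs_sum_le_sum_abs _ _).trans (Finset.sum_le_sum fun S hS => ?_)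
        rw [abs_mul, abs_sq, abs_pow]
        exact mul_le_mul_of_nonneg_left (pow_le_of_le_one (abs_nonneg _) hle (by simpa using hS))
          (sq_nonneg _)
    _ ≤ ∑ S, walshCoeff g S ^ 2 * |1 - 2 * p| :=
        Finset.sum_le_sum_of_subset_of_nonneg (Finset.erase_subset _ _) fun _ _ _ => by positivity

theorem integral_autocorr_sub_nonneg {n : ℕ} {p : ℝ} (hp : p ∈ Set.Icc (0 : ℝ) (1 / 2))
    (g : Cube n → ℝ) :
    0 ≤ ∫ D, autocorr g D ∂flips n p - ∫ D, autocorr g D ∂flips n (1 / 2) := by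
  rw [integral_autocorr_sub ⟨hp.1, by linarith [hp.2]⟩]
  have : 0 ≤ 1 - 2 * p := by linarith [hp.2]
  positivity

theorem autocorr_toReal_one {n : ℕ} (f : BoolFun n) : autocorr (toReal ∘ f) 1 = 1 := by
  simp only [autocorr, pairAvg, Function.comp_apply, mul_one, toReal_mul_self, integral_const,
    probReal_univ, one_smul]

/-! ### Covariances -/

theorem pairAvg_snd {n : ℕ} (g : Cube n → ℝ) (D : Cube n) :
    pairAvg (fun q => g q.2) D = ∫ u, g u ∂flips n (1 / 2) := by
  rw [pairAvg, integral_flips_half, integral_flips_half]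
  congr 1
  exact Equiv.sum_comp (Equiv.mulRight D) g

theorem noiseCov_eq {n : ℕ} {p : ℝ} (hp : p ∈ Set.Icc (0 : ℝ) 1) (f : BoolFun n) :
    noiseCov f p = ∫ D, autocorr (toReal ∘ f) D ∂flips n p -
      ∫ D, autocorr (toReal ∘ f) D ∂flips n (1 / 2) := by
  have := isProbabilityMeasure_noisePair n hp
  have := isProbabilityMeasure_flips n hp
  have hfst : ∫ q, toReal (f q.1) ∂noisePair n p = ∫ u, toReal (f u) ∂flips n (1 / 2) := by
    simp [integral_noisePair p fun q => toReal (f q.1), pairAvg]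
  have hsnd : ∫ q, toReal (f q.2) ∂noisePair n p = ∫ u, toReal (f u) ∂flips n (1 / 2) := by
    simp [integral_noisePair p fun q => toReal (f q.2), pairAvg_snd fun u => toReal (f u)]
  rw [noiseCov, covariance_eq_sub MemLp.of_discrete MemLp.of_discrete, hfst, hsnd,
    integral_autocorr_half, sq]
  exact congrArg (· - _) (integral_noisePair p fun q => toReal (f q.1) * toReal (f q.2))

theorem noiseCov_nonneg {n : ℕ} {p : ℝ} (hp : p ∈ Set.Icc (0 : ℝ) (1 / 2)) (f : BoolFun n) :
    0 ≤ noiseCov f p := by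
  rw [noiseCov_eq ⟨hp.1, by linarith [hp.2]⟩]
  exact integral_autocorr_sub_nonneg hp _

theorem annealedCov_netLaw {n : ℕ} {p : ℝ} (hp : p ∈ Set.Icc (0 : ℝ) 1) (T : ℕ) (h : BoolFun n) :
    annealedCov (netLaw T h) p = ∫ D, autocorr (toReal ∘ h) D ∂quotLaw n p T -
      ∫ D, autocorr (toReal ∘ h) D ∂flips n (1 / 2) := by
  have := isProbabilityMeasure_noisePair n hp
  have := isProbabilityMeasure_quotLaw n hp T
  have hfst := integral_netLaw_noisePair p T h fun q => toReal q.1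
  have hsnd := integral_netLaw_noisePair p T h fun q => toReal q.2
  have hmul := integral_netLaw_noisePair p T h fun q => toReal q.1 * toReal q.2
  simp only [pairAvg_snd fun u => toReal (h u), integral_const, probReal_univ, one_smul]
    at hfst hsnd
  rw [annealedCov, covariance_eq_sub MemLp.of_discrete MemLp.of_discrete]
  simp only [Pi.mul_apply]
  rw [integral_prod _ Integrable.of_finite, integral_prod _ Integrable.of_finite,
    integral_prod _ Integrable.of_finite]
  simp only [hfst, hsnd, hmul, integral_autocorr_half, sq]
  simp [autocorr, pairAvg]

theorem integral_noiseCov_netLaw {n : ℕ} {p : ℝ} (hp : p ∈ Set.Icc (0 : ℝ) 1) (T : ℕ)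
    (h : BoolFun n) :
    ∫ f, noiseCov f p ∂netLaw T h = ∫ D, autocorr (toReal ∘ h) D ∂quotLaw n p T -
      ∫ D, autocorr (toReal ∘ h) D ∂quotLaw n (1 / 2) T := by
  have havg (r : ℝ) : ∫ f, ∫ D, autocorr (toReal ∘ f) D ∂flips n r ∂netLaw T h =
      ∫ D, autocorr (toReal ∘ h) D ∂quotLaw n r T := by
    simp only [autocorr, ← integral_noisePair, Function.comp_apply]
    exact integral_netLaw_noisePair r T h fun q => toReal q.1 * toReal q.2
  simp only [noiseCov_eq hp]
  rw [integral_sub Integrable.of_finite Integrable.of_finite, havg, havg]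

theorem abs_integral_autocorr_quotLaw_sub_le {n : ℕ} {p : ℝ} (hp : p ∈ Set.Icc (0 : ℝ) 1)
    (T : ℕ) (h : BoolFun n) :
    |∫ D, autocorr (toReal ∘ h) D ∂quotLaw n p T -
      ∫ D, autocorr (toReal ∘ h) D ∂quotLaw n (1 / 2) T| ≤ |1 - 2 * p| := by
  rw [← integral_noiseCov_netLaw hp]
  calc _ ≤ ∫ f, |noiseCov f p| ∂netLaw T h := abs_integral_le_integral_abs
    _ ≤ ∫ _, |1 - 2 * p| ∂netLaw T h := by
        refine integral_mono Integrable.of_finite Integrable.of_finite fun f => ?_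
        simpa only [noiseCov_eq hp, autocorr_toReal_one, one_mul] using
          abs_integral_autocorr_sub_le hp (toReal ∘ f)
    _ = |1 - 2 * p| := by simp

/-! ### The separation probability -/

theorem monotone_sepProb : Monotone sepProb := fun _ _ h =>
  div_le_div_of_nonneg_right (Real.antitone_arccos (by linarith)) Real.pi_pos.le

theorem sepProb_one_sub (x : ℝ) : sepProb (1 - x) = 1 - sepProb x := by
  unfold sepProb
  rw [show 1 - 2 * (1 - x) = -(1 - 2 * x) by ring, Real.arccos_neg]
  field_simp

theorem two_div_pi_mul_sqrt_le_sepProb {x : ℝ} (hx : x ∈ Set.Icc (0 : ℝ) 1) :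
    2 / Real.pi * √x ≤ sepProb x := by
  have hp := (sepProb_mem_Icc x).1
  rw [← sin_pi_mul_sepProb_div_two hx]
  calc _ ≤ 2 / Real.pi * (Real.pi * sepProb x / 2) := by gcongr; exact Real.sin_le (by positivity)
    _ = sepProb x := by field_simp

theorem sepProb_le_sqrt {x : ℝ} (hx : x ∈ Set.Icc (0 : ℝ) 1) : sepProb x ≤ √x := by
  obtain ⟨hp0, hp1⟩ := sepProb_mem_Icc x
  rw [← sin_pi_mul_sepProb_div_two hx]
  calc sepProb x = 2 / Real.pi * (Real.pi * sepProb x / 2) := by field_simp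
    _ ≤ _ := Real.mul_le_sin (by positivity) (by nlinarith [Real.pi_pos])

theorem arcsin_le_chord {b y : ℝ} (hb : b ∈ Set.Ioc 0 (Real.pi / 2))
    (hy : y ∈ Set.Icc 0 (Real.sin b)) : Real.arcsin y ≤ b / Real.sin b * y := by
  have hpi := Real.pi_pos
  have hsin : 0 < Real.sin b := Real.sin_pos_of_pos_of_lt_pi hb.1 (by linarith [hb.2])
  have hratio : y / Real.sin b ≤ 1 := div_le_one_of_le₀ hy.2 hsin.le
  have hratio0 : 0 ≤ y / Real.sin b := div_nonneg hy.1 hsin.le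
  have hconcave := strictConcaveOn_sin_Icc.concaveOn.2 (x := 0) (y := b) ⟨le_rfl, hpi.le⟩
    ⟨hb.1.le, by linarith [hb.2]⟩ (sub_nonneg.2 hratio) hratio0 (by ring)
  simp only [Real.sin_zero, smul_eq_mul, mul_zero, zero_add, div_mul_cancel₀ _ hsin.ne'] at hconcave
  have hle : y / Real.sin b * b ≤ b := mul_le_of_le_one_left hb.1.le hratio
  have hge : 0 ≤ y / Real.sin b * b := mul_nonneg hratio0 hb.1.le
  rw [div_mul_comm, Real.arcsin_le_iff_le_sin ⟨by linarith [hy.1], hy.2.trans (Real.sin_le_one b)⟩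
    ⟨by linarith, by linarith [hb.2]⟩]
  exact hconcave

theorem abs_one_sub_two_mul_sepProb_le_chord {b x : ℝ} (hb : b ∈ Set.Ioc 0 (Real.pi / 2))
    (hx : |1 - 2 * x| ≤ Real.sin b) :
    |1 - 2 * sepProb x| ≤ 2 / Real.pi * (b / Real.sin b) * |1 - 2 * x| := by
  have harcsin : 1 - 2 * sepProb x = 2 / Real.pi * Real.arcsin (1 - 2 * x) := by
    rw [sepProb, Real.arccos_eq_pi_div_two_sub_arcsin]
    field_simp
    ring
  have habs : |Real.arcsin (1 - 2 * x)| = Real.arcsin |1 - 2 * x| := by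
    rcases le_total 0 (1 - 2 * x) with h | h
    · rw [abs_of_nonneg h, abs_of_nonneg (Real.arcsin_nonneg.2 h)]
    · rw [abs_of_nonpos h, Real.arcsin_neg, abs_of_nonpos (Real.arcsin_nonpos.2 h)]
  rw [harcsin, abs_mul, abs_of_pos (by positivity : 0 < 2 / Real.pi), habs, mul_assoc]
  gcongr
  exact arcsin_le_chord hb ⟨abs_nonneg _, hx⟩

theorem abs_one_sub_two_mul_sepProb_le {x : ℝ} (hx : x ∈ Set.Icc (0 : ℝ) 1) :
    |1 - 2 * sepProb x| ≤ |1 - 2 * x| := by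
  have hpi := Real.pi_pos
  have hchord := abs_one_sub_two_mul_sepProb_le_chord (x := x) ⟨half_pos hpi, le_rfl⟩
    (by rw [Real.sin_pi_div_two]; exact abs_le.2 ⟨by linarith [hx.2], by linarith [hx.1]⟩)
  rwa [Real.sin_pi_div_two, div_one, div_mul_div_cancel₀ hpi.ne', div_self two_ne_zero,
    one_mul] at hchord

theorem abs_one_sub_two_mul_sepProb_le_of_mem {x : ℝ}
    (hx : x ∈ Set.Icc (7 / 100 : ℝ) (93 / 100)) :
    |1 - 2 * sepProb x| ≤ 4 / 5 * |1 - 2 * x| := by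
  -- The interval is chosen so that `|1 - 2 * x| ≤ 86 / 100 < sin (π / 3)`.
  have hpi := Real.pi_pos
  have hsqrt : (1.73 : ℝ) ≤ √3 := Real.le_sqrt_of_sq_le (by norm_num)
  have hchord := abs_one_sub_two_mul_sepProb_le_chord (b := Real.pi / 3) (x := x)
    ⟨by positivity, by linarith⟩ (by
      rw [Real.sin_pi_div_three]
      exact abs_le.2 ⟨by linarith [hx.2], by linarith [hx.1]⟩)
  refine hchord.trans (mul_le_mul_of_nonneg_right ?_ (abs_nonneg _))
  rw [Real.sin_pi_div_three]
  calc 2 / Real.pi * (Real.pi / 3 / (√3 / 2)) = 4 / 3 / √3 := by field_simp; norm_num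
    _ ≤ 4 / 3 / 1.73 := by gcongr
    _ ≤ 4 / 5 := by norm_num

theorem le_sepProb_of_le {x : ℝ} (hx : 7 / 100 ≤ x) : 39 / 250 ≤ sepProb x := by
  have hcontract := abs_one_sub_two_mul_sepProb_le_of_mem (x := 7 / 100) (by norm_num)
  rw [abs_le, abs_of_nonneg (by norm_num)] at hcontract
  linarith [hcontract.2, monotone_sepProb hx]

theorem sepProb_le_of_le {x : ℝ} (hx : x ≤ 93 / 100) : sepProb x ≤ 211 / 250 := by
  have hge := le_sepProb_of_le (x := 1 - x) (by linarith)
  rw [sepProb_one_sub] at hge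
  linarith

/-! ### Moments of the distance -/

theorem negFrac_eq_sum {n : ℕ} (D : Cube n) :
    negFrac D = (∑ i, (1 - toReal (D i)) / 2) / n := by
  have hbit (i : Fin n) : (1 - toReal (D i)) / 2 = if D i = -1 then 1 else 0 := by
    rcases Int.units_eq_one_or (D i) with h | h
    · rw [h, toReal_one, if_neg (by decide)]; norm_num
    · rw [h, toReal_neg, toReal_one, if_pos rfl]; norm_num
  simp only [hbit, Finset.sum_boole, negFrac, negSet]

theorem negFrac_neg {n : ℕ} (hn : 0 < n) (D : Cube n) : negFrac (-D) = 1 - negFrac D := by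
  have hn' : (n : ℝ) ≠ 0 := by exact_mod_cast hn.ne'
  rw [negFrac_eq_sum, negFrac_eq_sum, eq_sub_iff_add_eq, ← add_div, ← Finset.sum_add_distrib,
    div_eq_one_iff_eq hn']
  calc _ = ∑ _ : Fin n, (1 : ℝ) :=
        Finset.sum_congr rfl fun i _ => by rw [Pi.neg_apply, toReal_neg]; ring
    _ = n := by simp

theorem integral_negFrac {n : ℕ} (hn : 0 < n) {p : ℝ} (hp : p ∈ Set.Icc (0 : ℝ) 1) :
    ∫ D : Cube n, negFrac D ∂flips n p = p := by
  have := isProbabilityMeasure_flipLaw hp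
  have hcoord (i : Fin n) : ∫ D : Cube n, (1 - toReal (D i)) / 2 ∂flips n p = p := by
    have heval := integral_comp_eval (μ := fun _ : Fin n => flipLaw p) (i := i)
      (f := fun u => (1 - toReal u) / 2) (measurable_of_countable _).aestronglyMeasurable
    rw [flips, heval, integral_flipLaw hp, toReal_neg, toReal_one]
    ring
  simp only [negFrac_eq_sum]
  rw [integral_div, integral_finsetSum _ fun _ _ => Integrable.of_finite]
  simp only [hcoord, Finset.sum_const, Finset.card_univ, Fintype.card_fin, nsmul_eq_mul]
  exact mul_div_cancel_left₀ p (by exact_mod_cast hn.ne')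

theorem variance_negFrac {n : ℕ} {p : ℝ} (hp : p ∈ Set.Icc (0 : ℝ) 1) :
    Var[fun D : Cube n => negFrac D; flips n p] = p * (1 - p) / n := by
  have := isProbabilityMeasure_flipLaw hp
  have hbit : Var[fun u => (1 - toReal u) / 2; flipLaw p] = p * (1 - p) := by
    rw [variance_eq_sub MemLp.of_discrete]
    simp only [Pi.pow_apply, integral_flipLaw hp, toReal_neg, toReal_one]
    ring
  have hsum := variance_sum_pi (μ := fun _ : Fin n => flipLaw p)
    (X := fun _ u => (1 - toReal u) / 2) fun _ => MemLp.of_discrete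
  simp only [hbit, Finset.sum_const, Finset.card_univ, Fintype.card_fin, nsmul_eq_mul] at hsum
  simp only [negFrac_eq_sum, div_eq_mul_inv _ (n : ℝ)]
  rw [variance_mul_const, ← Finset.sum_fn, flips, hsum]
  rcases eq_or_ne (n : ℝ) 0 with h | h
  · simp [h]
  · field_simp

theorem integral_one_sub_two_mul_negFrac_sq {n : ℕ} (hn : 0 < n) {p : ℝ}
    (hp : p ∈ Set.Icc (0 : ℝ) 1) :
    ∫ D : Cube n, (1 - 2 * negFrac D) ^ 2 ∂flips n p = (1 - 2 * p) ^ 2 + 4 * (p * (1 - p) / n) := by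
  have := isProbabilityMeasure_flips n hp
  have hvar := variance_eq_sub (μ := flips n p) (X := fun D : Cube n => negFrac D) MemLp.of_discrete
  simp only [Pi.pow_apply, variance_negFrac hp, integral_negFrac hn hp] at hvar
  rw [hvar]
  have hexpand (D : Cube n) :
      (1 - 2 * negFrac D) ^ 2 = 1 - 4 * negFrac D + 4 * negFrac D ^ 2 := by ring
  simp only [hexpand]
  rw [integral_add Integrable.of_finite Integrable.of_finite,
    integral_sub Integrable.of_finite Integrable.of_finite, integral_const_mul, integral_const_mul,
    integral_negFrac hn hp]
  simp only [integral_const, probReal_univ, one_smul]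
  ring

/-! ### Symmetry under a global flip -/

theorem flipLaw_map_neg (p : ℝ) : (flipLaw p).map (fun u => -u) = flipLaw (1 - p) := by
  have hmeas : Measurable fun u : ℤˣ => -u := measurable_of_countable _
  rw [flipLaw, flipLaw, Measure.map_add _ _ hmeas, Measure.map_smul, Measure.map_smul,
    Measure.map_dirac' hmeas, Measure.map_dirac' hmeas, neg_neg, sub_sub_cancel, add_comm]

theorem integral_flips_neg {n : ℕ} (p : ℝ) (g : Cube n → ℝ) :
    ∫ D, g (-D) ∂flips n p = ∫ D, g D ∂flips n (1 - p) := by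
  have hpi := Measure.pi_map_pi (μ := fun _ : Fin n => flipLaw p) (f := fun _ (u : ℤˣ) => -u)
    (hμ := fun _ => by rw [flipLaw_map_neg]; infer_instance)
    (fun _ => (measurable_of_countable _).aemeasurable)
  simp only [flipLaw_map_neg] at hpi
  rw [flips, flips, ← hpi, integral_map (measurable_of_countable _).aemeasurable
    (measurable_of_countable _).aestronglyMeasurable]
  rfl

theorem integral_quotLaw_neg {n : ℕ} (hn : 0 < n) (p : ℝ) (t : ℕ) (g : Cube n → ℝ) :
    ∫ D, g (-D) ∂quotLaw n p t = ∫ D, g D ∂quotLaw n (1 - p) t := by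
  induction t generalizing g with
  | zero => exact integral_flips_neg p g
  | succ t ih =>
    simp only [integral_quotLaw_succ, integral_flips_neg, ← sepProb_one_sub, ← negFrac_neg hn]
    exact ih fun D => ∫ E, g E ∂flips n (sepProb (negFrac D))

theorem integral_quotLaw_half_eq_zero_of_odd {n : ℕ} (hn : 0 < n) (t : ℕ) {g : Cube n → ℝ}
    (hg : g.Odd) : ∫ D, g D ∂quotLaw n (1 / 2) t = 0 := by
  have hneg := integral_quotLaw_neg hn (1 / 2) t g
  simp only [hg _, integral_neg, sub_half] at hneg
  linarith

theorem odd_autocorr {n : ℕ} {h : BoolFun n} (hh : ∀ ω, h (-ω) = -h ω) :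
    (autocorr (toReal ∘ h)).Odd := fun D => by
  simp only [autocorr, pairAvg, Function.comp_apply, mul_neg, hh, toReal_neg, integral_neg]

/-! ### Escape from unbalanced quotients -/

theorem flips_real_negFrac_lt_le {n : ℕ} (hn : 0 < n) {p y : ℝ} (hp : p ∈ Set.Ioc (0 : ℝ) 1)
    (hy : y ≤ p / 2) : (flips n p).real {D | negFrac D < y} ≤ 4 / (n * p) := by
  have hp' : p ∈ Set.Icc (0 : ℝ) 1 := ⟨hp.1.le, hp.2⟩
  have := isProbabilityMeasure_flips n hp'
  have hp0 : 0 < p := hp.1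
  have hchebyshev := meas_ge_le_variance_div_sq (μ := flips n p) (X := fun D : Cube n => negFrac D)
    MemLp.of_discrete (half_pos hp.1)
  rw [variance_negFrac hp', integral_negFrac hn hp'] at hchebyshev
  have hn' : (0 : ℝ) < n := by exact_mod_cast hn
  calc (flips n p).real {D | negFrac D < y}
      ≤ (flips n p).real {D | p / 2 ≤ |negFrac D - p|} := by
        refine measureReal_mono fun D (hD : negFrac D < y) => ?_
        rw [Set.mem_ofPred_eq, le_abs]
        right
        linarith
    _ ≤ p * (1 - p) / n / (p / 2) ^ 2 :=
        ENNReal.toReal_le_of_le_ofReal (by have := hp.2; bound) hchebyshev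
    _ = 4 * (1 - p) / (n * p) := by field_simp; norm_num
    _ ≤ 4 / (n * p) := by gcongr; linarith

theorem one_le_prod_of_negFrac_lt {n : ℕ} {D : Cube n} (hD : negFrac D < 7 / 100) :
    1 ≤ ∏ i, if D i = -1 then ((51 / 50 : ℝ) ^ 13)⁻¹ else 51 / 50 := by
  have hcard : (negSet D).card + (negSet D)ᶜ.card = n := by
    rw [Finset.card_add_card_compl, Fintype.card_fin]
  have hle : 13 * (negSet D).card ≤ (negSet D)ᶜ.card := by
    rcases n.eq_zero_or_pos with rfl | hn
    · omega
    rw [negFrac, div_lt_iff₀ (by exact_mod_cast hn)] at hD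
    have : (14 * (negSet D).card : ℝ) ≤ n := by linarith
    have : 14 * (negSet D).card ≤ n := by exact_mod_cast this
    omega
  have hcompl : Finset.univ.filter (fun i => ¬D i = -1) = (negSet D)ᶜ := by
    ext i
    simp [negSet]
  rw [Finset.prod_ite, Finset.prod_const, Finset.prod_const, hcompl, inv_pow, ← pow_mul,
    inv_mul_eq_div, ← negSet, one_le_div (by positivity)]
  exact pow_le_pow_right₀ (by norm_num) hle

theorem flips_real_negFrac_lt_le_pow {n : ℕ} {p : ℝ} (hp : p ∈ Set.Icc (39 / 250 : ℝ) 1) :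
    (flips n p).real {D | negFrac D < 7 / 100} ≤ (99 / 100) ^ n := by
  have hp' : p ∈ Set.Icc (0 : ℝ) 1 := ⟨by linarith [hp.1], hp.2⟩
  -- Exponential moments: since `7 / 100 < 1 / 14`, on the event there are at least thirteen plus
  -- signs for each minus sign, so the weights multiply to at least `1`.
  set w : ℤˣ → ℝ := fun u => if u = -1 then ((51 / 50 : ℝ) ^ 13)⁻¹ else 51 / 50 with hw
  have hw0 (u : ℤˣ) : 0 ≤ w u := by simp only [hw]; split_ifs <;> positivity
  have hneg : w (-1) ≤ 78 / 100 := by simp only [hw, if_true]; norm_num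
  have hone : w 1 = 51 / 50 := if_neg (by decide)
  have := mul_meas_ge_le_integral_of_nonneg (μ := flips n p) (f := fun D => ∏ i, w (D i))
    (Eventually.of_forall fun D => Finset.prod_nonneg fun i _ => hw0 _) Integrable.of_finite 1
  rw [one_mul, integral_prod_flips hp' Finset.univ w, Finset.card_univ, Fintype.card_fin] at this
  calc _ ≤ (flips n p).real {D | 1 ≤ ∏ i, w (D i)} :=
        measureReal_mono fun D hD => one_le_prod_of_negFrac_lt hD
    _ ≤ ((1 - p) * w 1 + p * w (-1)) ^ n := this
    _ ≤ (99 / 100) ^ n := by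
        have : 0 ≤ 1 - p := sub_nonneg.2 hp.2
        have : 0 ≤ p := hp'.1
        refine pow_le_pow_left₀ (add_nonneg (mul_nonneg ‹_› (hw0 1)) (mul_nonneg ‹_› (hw0 _))) ?_ n
        rw [hone]
        nlinarith [hp.1]

theorem flips_real_neg {n : ℕ} (p : ℝ) (S : Set (Cube n)) :
    (flips n p).real {D | -D ∈ S} = (flips n (1 - p)).real S := by
  have hneg := integral_flips_neg p (S.indicator 1)
  rw [integral_indicator_one S.toFinite.measurableSet] at hneg
  rw [← hneg]
  exact (integral_indicator_one (Set.toFinite _).measurableSet).symm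

/-- The quotients whose fraction of minus signs lies outside `[y, 93/100]`. While the fraction stays
in this interval, it grows by a constant factor as long as it is small, and then contracts to
`1/2`. -/
def unbalanced (n : ℕ) (y : ℝ) : Set (Cube n) := {D | negFrac D ∉ Set.Icc y (93 / 100)}

theorem flips_real_unbalanced_le {n : ℕ} (hn : 0 < n) {p : ℝ}
    (hp : p ∈ Set.Icc (0 : ℝ) (211 / 250)) (y : ℝ) :
    (flips n p).real (unbalanced n y) ≤
      (flips n p).real {D | negFrac D < y} + (99 / 100) ^ n := by
  have hupper := flips_real_negFrac_lt_le_pow (n := n) (p := 1 - p)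
    ⟨by linarith [hp.2], by linarith [hp.1]⟩
  rw [← flips_real_neg] at hupper
  refine (measureReal_mono fun D hD => ?_).trans
    ((measureReal_union_le _ _).trans (add_le_add_right hupper _))
  simp only [Set.mem_union, Set.mem_ofPred_eq, negFrac_neg hn]
  by_contra! h
  exact hD ⟨h.1, by linarith [h.2]⟩

theorem quotLaw_real_succ {n : ℕ} (p : ℝ) (t : ℕ) (S : Set (Cube n)) :
    (quotLaw n p (t + 1)).real S =
      ∫ D, (flips n (sepProb (negFrac D))).real S ∂quotLaw n p t := by
  simp only [← integral_indicator_one S.toFinite.measurableSet]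
  exact integral_quotLaw_succ p t _

theorem quotLaw_real_succ_le {n : ℕ} {p : ℝ} (hp : p ∈ Set.Icc (0 : ℝ) 1) (t : ℕ)
    {S S' : Set (Cube n)} {c : ℝ} (hc : 0 ≤ c)
    (hS : ∀ D ∉ S', (flips n (sepProb (negFrac D))).real S ≤ c) :
    (quotLaw n p (t + 1)).real S ≤ (quotLaw n p t).real S' + c := by
  have := isProbabilityMeasure_quotLaw n hp t
  have hstep (D : Cube n) :
      (flips n (sepProb (negFrac D))).real S ≤ S'.indicator 1 D + c := by
    by_cases hD : D ∈ S'
    · rw [Set.indicator_of_mem hD]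
      exact measureReal_le_one.trans (le_add_of_nonneg_right hc)
    · rw [Set.indicator_of_notMem hD, zero_add]
      exact hS D hD
  rw [quotLaw_real_succ]
  calc _ ≤ ∫ D, (S'.indicator 1 D + c) ∂quotLaw n p t :=
        integral_mono Integrable.of_finite Integrable.of_finite hstep
    _ = _ := by
        rw [integral_add Integrable.of_finite Integrable.of_finite,
          integral_indicator_one S'.toFinite.measurableSet, integral_const, probReal_univ, one_smul]

theorem quotLaw_real_unbalanced_add_le {n : ℕ} (hn : 0 < n) {p : ℝ} (hp : p ∈ Set.Icc (0 : ℝ) 1)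
    (s r : ℕ) :
    (quotLaw n p (s + r)).real (unbalanced n (7 / 100)) ≤
      (quotLaw n p s).real (unbalanced n (7 / 100)) + 2 * r * (99 / 100) ^ n := by
  induction r with
  | zero => simp
  | succ r ih =>
    have hstep := quotLaw_real_succ_le hp (s + r) (S := unbalanced n (7 / 100))
      (S' := unbalanced n (7 / 100)) (c := 2 * (99 / 100) ^ n) (by positivity) fun D hD => by
        obtain ⟨hlo, hhi⟩ := not_not.1 hD
        linarith [flips_real_unbalanced_le hn
            ⟨(sepProb_mem_Icc _).1, sepProb_le_of_le hhi⟩ (7 / 100),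
          flips_real_negFrac_lt_le_pow (n := n) ⟨le_sepProb_of_le hlo, (sepProb_mem_Icc _).2⟩]
    rw [← add_assoc]
    push_cast
    linarith

theorem le_sepProb_half_of_le {x y : ℝ} (hy : y ∈ Set.Icc (0 : ℝ) (7 / 100))
    (hx : x ∈ Set.Icc y 1) : 11 / 10 * y ≤ sepProb x / 2 := by
  have hpi : 63 / 100 ≤ 2 / Real.pi := by
    rw [le_div_iff₀ Real.pi_pos]; linarith [Real.pi_lt_d2]
  have hsmall : √y ≤ 265 / 1000 := Real.sqrt_le_iff.2 ⟨by norm_num, by linarith [hy.2]⟩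
  have hsqrt : 63 / 100 * √y ≤ sepProb x :=
    calc 63 / 100 * √y ≤ 2 / Real.pi * √x := by gcongr; exact hx.1
      _ ≤ sepProb x := two_div_pi_mul_sqrt_le_sepProb ⟨hy.1.trans hx.1, hx.2⟩
  nlinarith [Real.mul_self_sqrt hy.1, Real.sqrt_nonneg y]

theorem one_div_le_negFrac {n : ℕ} {D : Cube n} (hD : 0 < negFrac D) :
    1 / (n : ℝ) ≤ negFrac D := by
  have hcard : (negSet D).card ≠ 0 := fun h => by simp [negFrac, h] at hD
  unfold negFrac
  gcongr
  exact_mod_cast Nat.one_le_iff_ne_zero.2 hcard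

theorem four_div_mul_sepProb_negFrac_le {n : ℕ} {D : Cube n} (hD : 0 < negFrac D) :
    4 / (n * sepProb (negFrac D)) ≤ 7 / √n := by
  rcases n.eq_zero_or_pos with rfl | hn
  · simp
  have hn' : (0 : ℝ) < n := by exact_mod_cast hn
  have hsqrt : 1 / √n ≤ √(negFrac D) := by
    rw [← Real.sqrt_one, ← Real.sqrt_div zero_le_one]
    exact Real.sqrt_le_sqrt (one_div_le_negFrac hD)
  have hsep : 2 / Real.pi * (1 / √n) ≤ sepProb (negFrac D) :=
    le_trans (by gcongr) (two_div_pi_mul_sqrt_le_sepProb (negFrac_mem_Icc D))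
  calc 4 / (n * sepProb (negFrac D)) ≤ 4 / (n * (2 / Real.pi * (1 / √n))) := by gcongr
    _ = 2 * Real.pi / √n := by
        nth_rewrite 1 [← Real.mul_self_sqrt hn'.le]
        field_simp
        norm_num
    _ ≤ 7 / √n := by gcongr; linarith [Real.pi_lt_d2]

theorem quotLaw_real_unbalanced_succ_le {n : ℕ} (hn : 0 < n) {p : ℝ}
    (hp : p ∈ Set.Icc (0 : ℝ) 1) (t : ℕ) {y y' : ℝ} (hy : y ∈ Set.Ioc (0 : ℝ) (7 / 100))
    (hy' : y' ≤ 11 / 10 * y) :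
    (quotLaw n p (t + 1)).real (unbalanced n y') ≤
      (quotLaw n p t).real (unbalanced n y) + (7 / √n + (99 / 100) ^ n) := by
  refine quotLaw_real_succ_le hp t (by positivity) fun D hD => ?_
  obtain ⟨hlo, hhi⟩ := not_not.1 hD
  have hgrow := le_sepProb_half_of_le ⟨hy.1.le, hy.2⟩ ⟨hlo, (negFrac_mem_Icc D).2⟩
  have hpos : 0 < sepProb (negFrac D) := by linarith [hy.1]
  have hlower := flips_real_negFrac_lt_le hn ⟨hpos, (sepProb_mem_Icc _).2⟩ (hy'.trans hgrow)
  linarith [flips_real_unbalanced_le hn ⟨hpos.le, sepProb_le_of_le hhi⟩ y',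
    four_div_mul_sepProb_negFrac_le (hy.1.trans_le hlo)]

theorem quotLaw_real_unbalanced_min_le {n : ℕ} (hn : 0 < n) {p : ℝ}
    (hp : p ∈ Set.Ioc (0 : ℝ) (1 / 2)) (s : ℕ) :
    (quotLaw n p s).real (unbalanced n (min (7 / 100) ((11 / 10) ^ s * (p / 2)))) ≤
      4 / (n * p) + (99 / 100) ^ n + s * (7 / √n + (99 / 100) ^ n) := by
  have hp0 : 0 < p := hp.1
  have hp1 : p ≤ 1 := by linarith [hp.2]
  induction s with
  | zero =>
    rw [Nat.cast_zero, zero_mul, add_zero, pow_zero, one_mul]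
    exact (flips_real_unbalanced_le hn ⟨hp0.le, by linarith [hp.2]⟩ _).trans
      (add_le_add_left (flips_real_negFrac_lt_le hn ⟨hp0, hp1⟩ (min_le_right _ _)) _)
  | succ s ih =>
    have hgrow : min (7 / 100) ((11 / 10) ^ (s + 1) * (p / 2)) ≤
        11 / 10 * min (7 / 100) ((11 / 10) ^ s * (p / 2)) := by
      rw [mul_min_of_nonneg _ _ (by norm_num : (0 : ℝ) ≤ 11 / 10)]
      exact min_le_min (by norm_num) (by rw [pow_succ']; linarith)
    have hstep := quotLaw_real_unbalanced_succ_le hn ⟨hp0.le, hp1⟩ s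
      ⟨by positivity, min_le_left _ _⟩ hgrow
    push_cast
    linarith

/-! ### Mixing of the quotient chain -/

/-- The mean of `|1 - 2 x|` for the fraction `x` of minus signs of the quotient after `t` layers. It
controls all remaining correlations at later times. -/
def meanBias (n : ℕ) (p : ℝ) (t : ℕ) : ℝ := ∫ D : Cube n, |1 - 2 * negFrac D| ∂quotLaw n p t

theorem abs_integral_autocorr_quotLaw_add_sub_le {n : ℕ} {p : ℝ} (hp : p ∈ Set.Icc (0 : ℝ) 1)
    (m k : ℕ) (h : BoolFun n) :
    |∫ D, autocorr (toReal ∘ h) D ∂quotLaw n p (m + 1 + k) -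
      ∫ D, autocorr (toReal ∘ h) D ∂quotLaw n (1 / 2) k| ≤
        meanBias n p m := by
  have := isProbabilityMeasure_quotLaw n hp m
  set c := ∫ D, autocorr (toReal ∘ h) D ∂quotLaw n (1 / 2) k
  calc _ = |∫ D, (∫ E, autocorr (toReal ∘ h) E ∂quotLaw n (sepProb (negFrac D)) k - c)
        ∂quotLaw n p m| := by
        rw [integral_quotLaw_add, integral_sub Integrable.of_finite Integrable.of_finite,
          integral_const, probReal_univ, one_smul]
    _ ≤ ∫ D, |∫ E, autocorr (toReal ∘ h) E ∂quotLaw n (sepProb (negFrac D)) k - c|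
        ∂quotLaw n p m := abs_integral_le_integral_abs
    _ ≤ _ := integral_mono Integrable.of_finite Integrable.of_finite fun D =>
        (abs_integral_autocorr_quotLaw_sub_le (sepProb_mem_Icc _) k h).trans
          (abs_one_sub_two_mul_sepProb_le (negFrac_mem_Icc D))

theorem one_sub_two_mul_sq_le_one {x : ℝ} (hx : x ∈ Set.Icc (0 : ℝ) 1) : (1 - 2 * x) ^ 2 ≤ 1 := by
  nlinarith [hx.1, hx.2]

theorem integral_one_sub_two_mul_negFrac_sq_succ_le {n : ℕ} (hn : 0 < n) {p : ℝ}
    (hp : p ∈ Set.Icc (0 : ℝ) 1) (t : ℕ) :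
    ∫ D : Cube n, (1 - 2 * negFrac D) ^ 2 ∂quotLaw n p (t + 1) ≤
      16 / 25 * ∫ D : Cube n, (1 - 2 * negFrac D) ^ 2 ∂quotLaw n p t + 1 / n +
        (quotLaw n p t).real (unbalanced n (7 / 100)) := by
  have := isProbabilityMeasure_quotLaw n hp t
  have hstep (D : Cube n) : ∫ E : Cube n, (1 - 2 * negFrac E) ^ 2 ∂flips n (sepProb (negFrac D)) ≤
      16 / 25 * (1 - 2 * negFrac D) ^ 2 + 1 / n + (unbalanced n (7 / 100)).indicator 1 D := by
    have hvar : 4 * (sepProb (negFrac D) * (1 - sepProb (negFrac D)) / n) ≤ 1 / n := by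
      rw [← mul_div_assoc]
      gcongr
      linarith [sq_nonneg (1 - 2 * sepProb (negFrac D))]
    rw [integral_one_sub_two_mul_negFrac_sq hn (sepProb_mem_Icc _)]
    by_cases hD : D ∈ unbalanced n (7 / 100)
    · rw [Set.indicator_of_mem hD, Pi.one_apply]
      linarith [one_sub_two_mul_sq_le_one (sepProb_mem_Icc (negFrac D)),
        sq_nonneg (1 - 2 * negFrac D)]
    · have hcontract := pow_le_pow_left₀ (abs_nonneg _)
        (abs_one_sub_two_mul_sepProb_le_of_mem (not_not.1 hD)) 2
      rw [mul_pow, sq_abs, sq_abs] at hcontract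
      rw [Set.indicator_of_notMem hD]
      linarith
  rw [integral_quotLaw_succ]
  refine (integral_mono Integrable.of_finite Integrable.of_finite hstep).trans_eq ?_
  rw [integral_add Integrable.of_finite Integrable.of_finite,
    integral_add Integrable.of_finite Integrable.of_finite, integral_const_mul,
    integral_indicator_one (Set.toFinite _).measurableSet, integral_const, probReal_univ, one_smul]

theorem integral_one_sub_two_mul_negFrac_sq_add_le {n : ℕ} (hn : 0 < n) {p : ℝ}
    (hp : p ∈ Set.Icc (0 : ℝ) 1) (s r : ℕ) :
    ∫ D : Cube n, (1 - 2 * negFrac D) ^ 2 ∂quotLaw n p (s + r) ≤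
      (16 / 25) ^ r + 3 * (1 / n + (quotLaw n p s).real (unbalanced n (7 / 100)) +
        2 * r * (99 / 100) ^ n) := by
  induction r with
  | zero =>
    have := isProbabilityMeasure_quotLaw n hp s
    have hle : ∫ D : Cube n, (1 - 2 * negFrac D) ^ 2 ∂quotLaw n p s ≤ ∫ _, 1 ∂quotLaw n p s :=
      integral_mono Integrable.of_finite Integrable.of_finite fun D =>
        one_sub_two_mul_sq_le_one (negFrac_mem_Icc D)
    rw [integral_const, probReal_univ, one_smul] at hle
    exact hle.trans (by rw [pow_zero]; exact le_add_of_nonneg_right (by positivity))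
  | succ r ih =>
    have hstep := integral_one_sub_two_mul_negFrac_sq_succ_le hn hp (s + r)
    have hunb := quotLaw_real_unbalanced_add_le hn hp s r
    have hunb0 := measureReal_nonneg (μ := quotLaw n p s) (s := unbalanced n (7 / 100))
    have hn0 : (0 : ℝ) ≤ 1 / n := by positivity
    have hpow0 : (0 : ℝ) ≤ (99 / 100) ^ n := by positivity
    have hmul0 : (0 : ℝ) ≤ r * (99 / 100) ^ n := by positivity
    rw [← add_assoc, pow_succ]
    push_cast
    linarith

theorem integral_abs_le_of_integral_sq_le {α : Type*} [MeasurableSpace α] {μ : Measure α}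
    [IsProbabilityMeasure μ] {X : α → ℝ} (hX : MemLp X 2 μ) {η : ℝ} (hη : 0 ≤ η)
    (h : ∫ a, X a ^ 2 ∂μ ≤ η ^ 2) : ∫ a, |X a| ∂μ ≤ η := by
  have hvar := variance_nonneg |X| μ
  rw [variance_eq_sub hX.abs] at hvar
  simp only [Pi.pow_apply, Pi.abs_apply, sq_abs] at hvar
  exact (sq_le_sq₀ (integral_nonneg fun a => abs_nonneg _) hη).1 (by linarith)

/-- The length of the growth phase from noise level `p`. -/
def growthTime (p : ℝ) : ℕ := ⌈11 * Real.log (1 / p)⌉₊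

theorem le_pow_growthTime_mul {p : ℝ} (hp : 0 < p) :
    7 / 100 ≤ (11 / 10) ^ growthTime p * (p / 2) := by
  have hlog : 1 / 11 ≤ Real.log (11 / 10) := by
    have := Real.one_sub_inv_le_log_of_pos (by norm_num : (0 : ℝ) < 11 / 10)
    norm_num at this ⊢
    exact this
  have hpow : 1 / p ≤ (11 / 10 : ℝ) ^ growthTime p := by
    rw [← Real.log_le_log_iff (by positivity) (by positivity), Real.log_pow]
    calc Real.log (1 / p) = 11 * Real.log (1 / p) * (1 / 11) := by ring
      _ ≤ growthTime p * (1 / 11) := by gcongr; exact Nat.le_ceil _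
      _ ≤ growthTime p * Real.log (11 / 10) := by gcongr
  calc (7 / 100 : ℝ) ≤ 1 / p * (p / 2) := by field_simp; norm_num
    _ ≤ _ := by gcongr

theorem growthTime_le {p : ℝ} (hp : p ∈ Set.Ioc (0 : ℝ) 1) :
    growthTime p ≤ 11 * Real.log (1 / p) + 1 :=
  (Nat.ceil_lt_add_one (mul_nonneg (by norm_num) (Real.log_nonneg
    (by rw [le_div_iff₀ hp.1, one_mul]; exact hp.2)))).le

/-- A bound for `1 / n` plus the probability that the quotient is still unbalanced at the end of the
growth phase from noise level `p`. -/
def growthErr (n : ℕ) (p : ℝ) : ℝ :=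
  1 / n + (4 / (n * p) + (99 / 100) ^ n + growthTime p * (7 / √n + (99 / 100) ^ n))

theorem meanBias_growthTime_add_le {n : ℕ} (hn : 0 < n) {ε p : ℝ} (hε : 0 < ε)
    (hp : p ∈ Set.Icc ε (1 / 2)) {r : ℕ} {η : ℝ} (hη : 0 ≤ η)
    (herr : (16 / 25) ^ r + 3 * (growthErr n ε + 2 * r * (99 / 100) ^ n) ≤ η ^ 2) :
    meanBias n p (growthTime ε + r) ≤ η := by
  obtain ⟨hεp, hp2⟩ := hp
  have hp0 : 0 < p := hε.trans_le hεp
  have hp' : p ∈ Set.Icc (0 : ℝ) 1 := ⟨hp0.le, by linarith⟩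
  have := isProbabilityMeasure_quotLaw n hp' (growthTime ε + r)
  have hthreshold : 7 / 100 ≤ (11 / 10) ^ growthTime ε * (p / 2) :=
    (le_pow_growthTime_mul hε).trans (by gcongr)
  have hunb := quotLaw_real_unbalanced_min_le hn ⟨hp0, hp2⟩ (growthTime ε)
  rw [min_eq_left hthreshold] at hunb
  have hnoise : 4 / (n * p) ≤ 4 / (n * ε) := by gcongr
  refine integral_abs_le_of_integral_sq_le MemLp.of_discrete hη
    ((integral_one_sub_two_mul_negFrac_sq_add_le hn hp' _ r).trans (le_trans ?_ herr))
  unfold growthErr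
  linarith

theorem tendsto_log_div_sqrt_atTop : Tendsto (fun n : ℕ => Real.log n / √n) atTop (𝓝 0) := by
  simpa only [Real.sqrt_eq_rpow, Function.comp_def] using
    (isLittleO_log_rpow_atTop one_half_pos).tendsto_div_nhds_zero.comp tendsto_natCast_atTop_atTop

theorem tendsto_log_mul_pow_atTop {q : ℝ} (hq : q ∈ Set.Ico (0 : ℝ) 1) :
    Tendsto (fun n : ℕ => Real.log n * q ^ n) atTop (𝓝 0) := by
  have hq0 : 0 ≤ q := hq.1
  refine squeeze_zero (fun n => mul_nonneg (Real.log_natCast_nonneg n) (by positivity))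
    (fun n => ?_) (tendsto_self_mul_const_pow_of_lt_one hq.1 hq.2)
  gcongr
  exact Real.log_le_self n.cast_nonneg

theorem eventually_pos_of_tendsto_natCast_mul {ε : ℕ → ℝ}
    (hn : Tendsto (fun n : ℕ => n * ε n) atTop atTop) : ∀ᶠ n in atTop, 0 < ε n := by
  filter_upwards [hn.eventually_gt_atTop 0] with n hpos
  exact pos_of_mul_pos_right hpos n.cast_nonneg

theorem eventually_growthTime_le {ε : ℕ → ℝ} (hε : ∀ n, ε n ≤ 1)
    (hn : Tendsto (fun n : ℕ => n * ε n) atTop atTop) :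
    ∀ᶠ n in atTop, growthTime (ε n) ≤ 11 * Real.log n + 1 := by
  filter_upwards [hn.eventually_ge_atTop 1, eventually_pos_of_tendsto_natCast_mul hn]
    with n hge hpos
  refine (growthTime_le ⟨hpos, hε n⟩).trans ?_
  gcongr
  rwa [div_le_iff₀ hpos]

theorem tendsto_growthErr {ε : ℕ → ℝ} (hε : ∀ n, ε n ≤ 1)
    (hn : Tendsto (fun n : ℕ => n * ε n) atTop atTop) :
    Tendsto (fun n => growthErr n (ε n)) atTop (𝓝 0) := by
  have hpow : Tendsto (fun n : ℕ => (99 / 100 : ℝ) ^ n) atTop (𝓝 0) :=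
    tendsto_pow_atTop_nhds_zero_of_lt_one (by norm_num) (by norm_num)
  have hsqrt : Tendsto (fun n : ℕ => 7 / √(n : ℝ)) atTop (𝓝 0) :=
    (Real.tendsto_sqrt_atTop.comp tendsto_natCast_atTop_atTop).const_div_atTop 7
  have hlogpow := tendsto_log_mul_pow_atTop (q := 99 / 100) (by norm_num)
  have hbound : Tendsto (fun n : ℕ => (11 * Real.log n + 1) * (7 / √n + (99 / 100) ^ n)) atTop
      (𝓝 0) := by
    have := ((tendsto_log_div_sqrt_atTop.const_mul 77).add (hlogpow.const_mul 11)).add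
      (hsqrt.add hpow)
    simp only [mul_zero, add_zero] at this
    exact this.congr fun n => by ring
  have hgrowth : Tendsto (fun n => growthTime (ε n) * (7 / √n + (99 / 100) ^ n)) atTop (𝓝 0) := by
    refine squeeze_zero' (Eventually.of_forall fun n => by positivity) ?_ hbound
    filter_upwards [eventually_growthTime_le hε hn] with n hle
    gcongr
  simpa only [growthErr, add_zero] using tendsto_one_div_atTop_nhds_zero_nat.add
    (((hn.const_div_atTop 4).add hpow).add hgrowth)

theorem mul_pow_le_exp_neg {n r : ℕ} (hr : (r : ℝ) ≤ Real.exp (n / 200)) :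
    r * (99 / 100 : ℝ) ^ n ≤ Real.exp (-(n / 200)) :=
  calc r * (99 / 100 : ℝ) ^ n ≤ Real.exp (n / 200) * Real.exp (-(1 / 100)) ^ n := by
        gcongr
        linarith [Real.add_one_le_exp (-(1 / 100))]
    _ = Real.exp (-(n / 200)) := by
        rw [← Real.exp_nat_mul, ← Real.exp_add]
        ring_nf

theorem tendsto_exp_natCast_div_atTop {c : ℝ} (hc : 0 < c) :
    Tendsto (fun n : ℕ => Real.exp (n / c)) atTop atTop :=
  Real.tendsto_exp_atTop.comp (tendsto_natCast_atTop_atTop.atTop_div_const hc)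

theorem exists_eventually_meanBias_le {ε : ℕ → ℝ} (hε : ∀ n, ε n ≤ 1)
    (hn : Tendsto (fun n : ℕ => n * ε n) atTop atTop) {η : ℝ} (hη : 0 < η) :
    ∃ R : ℕ, ∀ᶠ n : ℕ in atTop, ∀ p ∈ Set.Icc (ε n) (1 / 2), ∀ r ≥ R,
      (r : ℝ) ≤ Real.exp (n / 200) → meanBias n p (growthTime (ε n) + r) ≤ η := by
  obtain ⟨R, hR⟩ := exists_pow_lt_of_lt_one (by positivity : 0 < η ^ 2 / 2)
    (by norm_num : (16 / 25 : ℝ) < 1)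
  have herr : Tendsto (fun n : ℕ => 3 * (growthErr n (ε n) + 2 * Real.exp (-(n / 200)))) atTop
      (𝓝 0) := by
    have hexp := (tendsto_exp_natCast_div_atTop (by norm_num : (0 : ℝ) < 200)).inv_tendsto_atTop
    simpa [Real.exp_neg] using ((tendsto_growthErr hε hn).add (hexp.const_mul 2)).const_mul 3
  refine ⟨R, ?_⟩
  filter_upwards [herr.eventually_le_const (by positivity : 0 < η ^ 2 / 2), eventually_gt_atTop 0,
    eventually_pos_of_tendsto_natCast_mul hn] with n herr hn0 hpos p hp r hr hrexp
  refine meanBias_growthTime_add_le hn0 hpos hp hη.le ?_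
  have hpow : (16 / 25 : ℝ) ^ r ≤ (16 / 25) ^ R :=
    pow_le_pow_of_le_one (by norm_num) (by norm_num) hr
  linarith [mul_pow_le_exp_neg hrexp]

theorem eventually_growthTime_add_le {ε K : ℕ → ℝ} (hε : ∀ n, ε n ≤ 1 / 2)
    (hpos : ∀ᶠ n in atTop, 0 < ε n)
    (hK : Tendsto (fun n : ℕ => K n / Real.log (1 / ε n)) atTop atTop) (R : ℕ) :
    ∀ᶠ n in atTop, ((growthTime (ε n) + R : ℕ) : ℝ) ≤ K n := by
  filter_upwards [hpos, hK.eventually_ge_atTop (11 + 2 * (R + 1))] with n hp hM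
  have hlog : 1 / 2 ≤ Real.log (1 / ε n) :=
    calc (1 / 2 : ℝ) ≤ Real.log 2 := by linarith [Real.log_two_gt_d9]
      _ ≤ _ := Real.log_le_log two_pos (by rw [le_div_iff₀ hp]; linarith [hε n])
  rw [le_div_iff₀ (by linarith)] at hM
  have hgrowth := growthTime_le ⟨hp, (hε n).trans one_half_lt_one.le⟩
  have hR : (R + 1 : ℝ) * (1 / 2) ≤ (R + 1) * Real.log (1 / ε n) := by gcongr
  push_cast
  linarith

/-! ### Quantitative noise sensitivity -/

theorem annealedQNS_of_le_exp {ε K : ℕ → ℝ} (hε : ∀ n, ε n ≤ 1 / 2)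
    (hn : Tendsto (fun n : ℕ => n * ε n) atTop atTop)
    (hK : Tendsto (fun n : ℕ => K n / Real.log (1 / ε n)) atTop atTop)
    {T : ℕ → ℕ} (hT : ∀ᶠ n in atTop, K n ≤ T n ∧ (T n : ℝ) ≤ Real.exp (n / 200))
    (h : ∀ n, BoolFun n) : AnnealedQNS (fun n => netLaw (T n) (h n)) ε := by
  have hpos := eventually_pos_of_tendsto_natCast_mul hn
  refine Metric.tendsto_nhds.2 fun η hη => ?_
  obtain ⟨R, hbias⟩ :=
    exists_eventually_meanBias_le (fun n => (hε n).trans (by norm_num)) hn (half_pos hη)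
  filter_upwards [hbias, hpos, hT, eventually_growthTime_add_le hε hpos hK (R + 1)]
    with n hbias hpos ⟨hKT, hTexp⟩ hgrowth
  have hdepth : growthTime (ε n) + (R + 1) ≤ T n := by exact_mod_cast hgrowth.trans hKT
  obtain ⟨r, hr, hrT⟩ : ∃ r, R ≤ r ∧ T n = growthTime (ε n) + r + 1 :=
    ⟨T n - growthTime (ε n) - 1, by omega, by omega⟩
  have hrexp : (r : ℝ) ≤ Real.exp (n / 200) := le_trans (by exact_mod_cast (by omega)) hTexp
  have hp : ε n ∈ Set.Icc (0 : ℝ) 1 := ⟨hpos.le, by linarith [hε n]⟩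
  rw [Real.dist_eq, sub_zero, annealedCov_netLaw hp, hrT]
  calc _ ≤ meanBias n (ε n) (growthTime (ε n) + r) :=
        abs_integral_autocorr_quotLaw_add_sub_le hp _ 0 (h n)
    _ ≤ η / 2 := hbias _ ⟨le_rfl, hε n⟩ r hr hrexp
    _ < η := half_lt_self hη

/-- Running the last `k` layers from a balanced quotient is running them from a uniform one, so
past depth `K n` the autocorrelation no longer depends on the noise level. -/
theorem eventually_exists_abs_integral_autocorr_sub_le {ε K : ℕ → ℝ} (hε : ∀ n, ε n ≤ 1 / 2)
    (hn : Tendsto (fun n : ℕ => n * ε n) atTop atTop)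
    (hK : Tendsto (fun n : ℕ => K n / Real.log (1 / ε n)) atTop atTop) {η : ℝ} (hη : 0 < η) :
    ∀ᶠ n in atTop, ∀ T : ℕ, K n ≤ T → ∃ k, ∀ p ∈ Set.Icc (ε n) (1 / 2), ∀ h : BoolFun n,
      |∫ D, autocorr (toReal ∘ h) D ∂quotLaw n p T -
        ∫ D, autocorr (toReal ∘ h) D ∂quotLaw n (1 / 2) k| ≤ η := by
  have hpos := eventually_pos_of_tendsto_natCast_mul hn
  obtain ⟨R, hbias⟩ :=
    exists_eventually_meanBias_le (fun n => (hε n).trans (by norm_num)) hn hη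
  filter_upwards [hbias, hpos, eventually_growthTime_add_le hε hpos hK (R + 1),
    (tendsto_exp_natCast_div_atTop (by norm_num : (0 : ℝ) < 200)).eventually_ge_atTop (R : ℝ)]
    with n hbias hpos hgrowth hexp T hKT
  have hdepth : growthTime (ε n) + (R + 1) ≤ T := by exact_mod_cast hgrowth.trans hKT
  obtain ⟨k, rfl⟩ : ∃ k, T = growthTime (ε n) + R + 1 + k :=
    ⟨T - growthTime (ε n) - R - 1, by omega⟩
  refine ⟨k, fun p hp h => ?_⟩
  exact (abs_integral_autocorr_quotLaw_add_sub_le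
    ⟨hpos.le.trans hp.1, hp.2.trans (by norm_num)⟩ _ k h).trans (hbias p hp R le_rfl hexp)

theorem annealedQNS_of_odd {ε K : ℕ → ℝ} (hε : ∀ n, ε n ≤ 1 / 2)
    (hn : Tendsto (fun n : ℕ => n * ε n) atTop atTop)
    (hK : Tendsto (fun n : ℕ => K n / Real.log (1 / ε n)) atTop atTop)
    {T : ℕ → ℕ} (hT : ∀ᶠ n in atTop, K n ≤ T n)
    {h : ∀ n, BoolFun n} (hodd : ∀ n, 1 ≤ n → ∀ ω, h n (-ω) = -h n ω) :
    AnnealedQNS (fun n => netLaw (T n) (h n)) ε := by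
  refine Metric.tendsto_nhds.2 fun η hη => ?_
  filter_upwards [eventually_exists_abs_integral_autocorr_sub_le hε hn hK (half_pos hη),
    eventually_pos_of_tendsto_natCast_mul hn, eventually_gt_atTop 0, hT]
    with n hclose hpos hn0 hKT
  obtain ⟨k, hk⟩ := hclose (T n) hKT
  have hzero (t : ℕ) : ∫ D, autocorr (toReal ∘ h n) D ∂quotLaw n (1 / 2) t = 0 :=
    integral_quotLaw_half_eq_zero_of_odd hn0 t (odd_autocorr (hodd n hn0))
  have hmean : ∫ D, autocorr (toReal ∘ h n) D ∂flips n (1 / 2) = 0 := hzero 0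
  have hbound := hk (ε n) ⟨le_rfl, hε n⟩ (h n)
  rw [Real.dist_eq, sub_zero, annealedCov_netLaw ⟨hpos.le, by linarith [hε n]⟩, hmean]
  rw [hzero] at hbound
  exact hbound.trans_lt (half_lt_self hη)

theorem one_sub_le_measureReal_lt {α : Type*} [MeasurableSpace α] {μ : Measure α}
    [IsProbabilityMeasure μ] {X : α → ℝ} (hmeas : Measurable X) (hint : Integrable X μ)
    (hX : ∀ a, 0 ≤ X a) {δ : ℝ} (hδ : 0 < δ) (h : ∫ a, X a ∂μ ≤ δ * δ) :
    1 - δ ≤ μ.real {a | X a < δ} := by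
  have hmarkov := mul_meas_ge_le_integral_of_nonneg (Eventually.of_forall hX) hint δ
  have htail : μ.real {a | δ ≤ X a} ≤ δ := le_of_mul_le_mul_left (hmarkov.trans h) hδ
  have hcompl : {a | X a < δ} = {a | δ ≤ X a}ᶜ := by ext a; simp
  rw [hcompl, probReal_compl_eq_one_sub (measurableSet_le measurable_const hmeas)]
  linarith

theorem quenchedQNS_netLaw {ε K : ℕ → ℝ} (hε : ∀ n, ε n ≤ 1 / 2)
    (hn : Tendsto (fun n : ℕ => n * ε n) atTop atTop)
    (hK : Tendsto (fun n : ℕ => K n / Real.log (1 / ε n)) atTop atTop)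
    {T : ℕ → ℕ} (hT : ∀ᶠ n in atTop, K n ≤ T n) (h : ∀ n, BoolFun n) :
    QuenchedQNS (fun n => netLaw (T n) (h n)) ε := by
  intro δ hδ
  rw [← eventually_atTop]
  filter_upwards [eventually_exists_abs_integral_autocorr_sub_le hε hn hK
      (by positivity : 0 < δ * δ / 2), eventually_pos_of_tendsto_natCast_mul hn, hT]
    with n hclose hpos hKT
  obtain ⟨k, hk⟩ := hclose (T n) hKT
  have hnoise := hk (ε n) ⟨le_rfl, hε n⟩ (h n)
  have hfull := hk (1 / 2) ⟨hε n, le_rfl⟩ (h n)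
  have hmean : ∫ f, noiseCov f (ε n) ∂netLaw (T n) (h n) ≤ δ * δ := by
    rw [integral_noiseCov_netLaw ⟨hpos.le, by linarith [hε n]⟩]
    linarith [(abs_le.1 hnoise).2, (abs_le.1 hfull).1]
  calc 1 - δ ≤ (netLaw (T n) (h n)).real {f | noiseCov f (ε n) < δ} :=
        one_sub_le_measureReal_lt (measurable_of_countable _) Integrable.of_finite
          (noiseCov_nonneg ⟨hpos.le, hε n⟩) hδ hmean
    _ ≤ _ := measureReal_mono fun f (hf : noiseCov f (ε n) < δ) => hf.le

/-! ### Coalescence at very large depth -/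

/-- The quotients other than `1` and `-1`. The two exceptional quotients are absorbing: equal
states stay equal, and opposite ones stay opposite. -/
def separated (n : ℕ) : Set (Cube n) := {D | D ≠ 1 ∧ D ≠ -1}

theorem flips_real_separated_le {n : ℕ} {p : ℝ} (hp : p ∈ Set.Icc (0 : ℝ) 1) :
    (flips n p).real (separated n) ≤ 1 - max (1 - p) p ^ n := by
  have := isProbabilityMeasure_flips n hp
  have hone : (flips n p).real {1} = (1 - p) ^ n := by
    simp [flips_real_singleton, flipLaw_real_one hp.2]
  have hneg : (flips n p).real {-1} = p ^ n := by
    simp [flips_real_singleton, flipLaw_real_neg_one hp.1]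
  have hle (v : Cube n) (hv : v ∉ separated n) :
      (flips n p).real (separated n) ≤ 1 - (flips n p).real {v} := by
    rw [← probReal_compl_eq_one_sub (measurableSet_singleton v)]
    exact measureReal_mono fun D hD => ne_of_mem_of_not_mem hD hv
  rcases max_choice (1 - p) p with hmax | hmax <;> rw [hmax]
  · exact hone ▸ hle 1 fun h => h.1 rfl
  · exact hneg ▸ hle (-1) fun h => h.2 rfl

theorem flips_sepProb_real_separated_le {n : ℕ} (hn : 0 < n) (D : Cube n) :
    (flips n (sepProb (negFrac D))).real (separated n) ≤
      (1 - (1 / 2) ^ n) * (separated n).indicator 1 D := by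
  refine (flips_real_separated_le (sepProb_mem_Icc _)).trans ?_
  by_cases hD : D ∈ separated n
  · rw [Set.indicator_of_mem hD, Pi.one_apply, mul_one]
    gcongr
    rcases le_total (sepProb (negFrac D)) (1 / 2) with h | h
    · exact le_max_of_le_left (by linarith)
    · exact le_max_of_le_right h
  · rw [Set.indicator_of_notMem hD, mul_zero, sub_nonpos]
    have hfrac_one : negFrac (1 : Cube n) = 0 := by simp [negFrac, negSet]
    refine one_le_pow₀ ?_
    rcases not_and_or.1 hD with h | h
    · rw [not_not.1 h, hfrac_one]
      exact le_max_of_le_left (by simp [sepProb])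
    · rw [not_not.1 h, negFrac_neg hn, hfrac_one]
      refine le_max_of_le_right ?_
      rw [sepProb_one_sub]
      simp [sepProb]

theorem quotLaw_real_separated_le {n : ℕ} (hn : 0 < n) {p : ℝ} (hp : p ∈ Set.Icc (0 : ℝ) 1)
    (t : ℕ) : (quotLaw n p t).real (separated n) ≤ (1 - (1 / 2) ^ n) ^ t := by
  have hrate : (0 : ℝ) ≤ 1 - (1 / 2) ^ n := sub_nonneg.2 (pow_le_one₀ (by norm_num) (by norm_num))
  induction t with
  | zero =>
    have := isProbabilityMeasure_quotLaw n hp 0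
    exact measureReal_le_one
  | succ t ih =>
    calc (quotLaw n p (t + 1)).real (separated n)
        ≤ ∫ D, (1 - (1 / 2) ^ n) * (separated n).indicator 1 D ∂quotLaw n p t := by
          rw [quotLaw_real_succ]
          exact integral_mono Integrable.of_finite Integrable.of_finite
            (flips_sepProb_real_separated_le hn)
      _ = (1 - (1 / 2) ^ n) * (quotLaw n p t).real (separated n) := by
          rw [integral_const_mul, integral_indicator_one (Set.toFinite _).measurableSet]
      _ ≤ (1 - (1 / 2) ^ n) ^ (t + 1) := by rw [pow_succ']; gcongr

theorem neg_one_le_autocorr_toReal {n : ℕ} (h : BoolFun n) (D : Cube n) :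
    -1 ≤ autocorr (toReal ∘ h) D := by
  have hpair (u v : ℤˣ) : -1 ≤ toReal u * toReal v := by
    rw [← toReal_mul]
    rcases Int.units_eq_one_or (u * v) with huv | huv <;> rw [huv] <;> simp [toReal]
  calc (-1 : ℝ) = ∫ _, -1 ∂flips n (1 / 2) := by rw [integral_const, probReal_univ, one_smul]
    _ ≤ autocorr (toReal ∘ h) D :=
        integral_mono Integrable.of_finite Integrable.of_finite fun u => hpair _ _

theorem one_sub_le_autocorr_of_even {n : ℕ} {h : BoolFun n} (hh : h.Even) (D : Cube n) :
    1 - 2 * (separated n).indicator 1 D ≤ autocorr (toReal ∘ h) D := by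
  by_cases hD : D ∈ separated n
  · rw [Set.indicator_of_mem hD, Pi.one_apply]
    linarith [neg_one_le_autocorr_toReal h D]
  · rw [Set.indicator_of_notMem hD, mul_zero, sub_zero, ← autocorr_toReal_one h]
    rcases not_and_or.1 hD with h1 | h1 <;> rw [not_not.1 h1]
    simp only [autocorr, pairAvg, Function.comp_apply, mul_neg, hh _, le_refl]

theorem one_sub_le_annealedCov_of_even {n : ℕ} (hn : 0 < n) {p : ℝ} (hp : p ∈ Set.Icc (0 : ℝ) 1)
    (T : ℕ) {h : BoolFun n} (heven : h.Even) (hmean : ∫ u, toReal (h u) ∂flips n (1 / 2) = 0) :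
    1 - 2 * (1 - (1 / 2) ^ n) ^ T ≤ annealedCov (netLaw T h) p := by
  have := isProbabilityMeasure_quotLaw n hp T
  have hmean' : ∫ u, (toReal ∘ h) u ∂flips n (1 / 2) = 0 := hmean
  rw [annealedCov_netLaw hp, integral_autocorr_half, hmean', sq, mul_zero, sub_zero]
  calc 1 - 2 * (1 - (1 / 2) ^ n) ^ T ≤ 1 - 2 * (quotLaw n p T).real (separated n) := by
        gcongr; exact quotLaw_real_separated_le hn hp T
    _ = ∫ D, (1 - 2 * (separated n).indicator 1 D) ∂quotLaw n p T := by
        rw [integral_sub Integrable.of_finite Integrable.of_finite, integral_const_mul,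
          integral_indicator_one (Set.toFinite _).measurableSet, integral_const, probReal_univ,
          one_smul]
    _ ≤ _ := integral_mono Integrable.of_finite Integrable.of_finite
        (one_sub_le_autocorr_of_even heven)

/-- The parity of the coordinates in `S`: the Walsh character at `S` as a Boolean function. -/
def parity {n : ℕ} (S : Finset (Fin n)) : BoolFun n := fun ω => ∏ i ∈ S, ω i

theorem even_parity {n : ℕ} {S : Finset (Fin n)} (hS : Even S.card) : (parity S).Even := fun ω => by
  simp [parity, Finset.prod_neg, hS.neg_one_pow]

theorem integral_parity {n : ℕ} {S : Finset (Fin n)} (hS : S.Nonempty) :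
    ∫ u, toReal (parity S u) ∂flips n (1 / 2) = 0 := by
  have hchar (u : Cube n) : toReal (parity S u) = walshChar S u := by
    simp [parity, walshChar, toReal]
  simp only [hchar, integral_walshChar (by norm_num : (1 / 2 : ℝ) ∈ Set.Icc (0 : ℝ) 1)]
  norm_num [hS.ne_empty]

theorem exists_not_annealedNoiseSensitive :
    ∃ (h : ∀ n, BoolFun n) (τ : ℕ → ℕ), ∀ T : ℕ → ℕ, (∀ᶠ n : ℕ in atTop, τ n ≤ T n) →
      ¬AnnealedNoiseSensitive fun n => netLaw (T n) (h n) := by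
  have hrate (n : ℕ) : 0 ≤ 1 - (1 / 2 : ℝ) ^ n ∧ 1 - (1 / 2 : ℝ) ^ n < 1 :=
    ⟨sub_nonneg.2 (pow_le_one₀ (by norm_num) (by norm_num)), sub_lt_self _ (by positivity)⟩
  choose τ hτ using fun n => exists_pow_lt_of_lt_one (by norm_num : (0 : ℝ) < 1 / 4) (hrate n).2
  refine ⟨fun n => parity {i | i.val < 2}, τ, fun T hT hsens => ?_⟩
  have hlim := (hsens (1 / 2) (by norm_num) le_rfl).eventually_lt_const
    (by norm_num : (0 : ℝ) < 1 / 2)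
  obtain ⟨n, hcov, hτT, hn : 2 ≤ n⟩ := (hlim.and (hT.and (eventually_ge_atTop 2))).exists
  have hcard : (Finset.univ.filter fun i : Fin n => i.val < 2).card = 2 := by
    rw [Fin.card_filter_val_lt, min_eq_right hn]
  have hlower := one_sub_le_annealedCov_of_even (p := 1 / 2) (by omega : 0 < n) (by norm_num) (T n)
    (even_parity (by rw [hcard]; exact even_two))
    (integral_parity (Finset.card_pos.1 (by rw [hcard]; exact two_pos)))
  linarith [hτ n, pow_le_pow_of_le_one (hrate n).1 (hrate n).2.le hτT]

/-! ### Stability at bounded depth -/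

/-- The probability `P(f(ω) ≠ f(ω^p))` that noise of level `p` changes the value of `f`. -/
def disagreeProb {n : ℕ} (f : BoolFun n) (p : ℝ) : ℝ :=
  (noisePair n p).real {q | f q.1 ≠ f q.2}

theorem disagreeProb_eq_integral {n : ℕ} (f : BoolFun n) (p : ℝ) :
    disagreeProb f p = ∫ q, {v : ℤˣ × ℤˣ | v.1 ≠ v.2}.indicator 1 (f q.1, f q.2) ∂noisePair n p :=
  (integral_indicator_one (Set.toFinite _).measurableSet).symm

theorem disagreeProb_zero {n : ℕ} (f : BoolFun n) : disagreeProb f 0 = 0 := by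
  have hdirac : flips n 0 = Measure.dirac 1 := by
    have hbit : flipLaw 0 = Measure.dirac 1 := by simp [flipLaw]
    rw [flips, hbit, ← Measure.infinitePi_eq_pi, Measure.infinitePi_dirac]
    rfl
  rw [disagreeProb_eq_integral, integral_noisePair, hdirac, integral_dirac]
  simp [pairAvg]

theorem integral_disagreeProb_netLaw_zero {n : ℕ} (p : ℝ) (h : BoolFun n) :
    ∫ f, disagreeProb f p ∂netLaw 0 h = disagreeProb h p := by
  simp only [disagreeProb_eq_integral]
  rw [integral_netLaw_noisePair, integral_noisePair]
  rfl

theorem integral_disagreeProb_netLaw_succ {n : ℕ} (p : ℝ) (t : ℕ) (h : BoolFun n) :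
    ∫ f, disagreeProb f p ∂netLaw (t + 1) h =
      ∫ D, disagreeProb h (sepProb (negFrac D)) ∂quotLaw n p t := by
  simp only [disagreeProb_eq_integral]
  rw [integral_netLaw_noisePair, integral_quotLaw_succ]
  simp only [integral_noisePair]

theorem integral_negFrac_le {n : ℕ} {p : ℝ} (hp : p ∈ Set.Icc (0 : ℝ) 1) :
    ∫ D : Cube n, negFrac D ∂flips n p ≤ p := by
  rcases n.eq_zero_or_pos with rfl | hn
  · simpa [negFrac] using hp.1
  · exact (integral_negFrac hn hp).le

theorem integral_sepProb_quotLaw_le_sqrt {n : ℕ} {p : ℝ} (hp : p ∈ Set.Icc (0 : ℝ) 1) (t : ℕ) :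
    ∫ D, sepProb (negFrac D) ∂quotLaw n p t ≤ √(∫ D, negFrac D ∂quotLaw n p t) := by
  have := isProbabilityMeasure_quotLaw n hp t
  have hmean : 0 ≤ ∫ D, negFrac D ∂quotLaw n p t := integral_nonneg fun D => (negFrac_mem_Icc D).1
  calc ∫ D, sepProb (negFrac D) ∂quotLaw n p t ≤ ∫ D, |√(negFrac D)| ∂quotLaw n p t :=
        integral_mono Integrable.of_finite Integrable.of_finite fun D =>
          (sepProb_le_sqrt (negFrac_mem_Icc D)).trans (le_abs_self _)
    _ ≤ √(∫ D, negFrac D ∂quotLaw n p t) :=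
        integral_abs_le_of_integral_sq_le MemLp.of_discrete (Real.sqrt_nonneg _) <| by
          simp only [Real.sq_sqrt (negFrac_mem_Icc _).1, Real.sq_sqrt hmean, le_refl]

theorem sqrt_rpow_half_pow {p : ℝ} (hp : 0 ≤ p) (t : ℕ) :
    √(p ^ ((1 / 2 : ℝ) ^ t)) = p ^ ((1 / 2 : ℝ) ^ (t + 1)) := by
  rw [Real.sqrt_eq_rpow, ← Real.rpow_mul hp, pow_succ]

theorem integral_negFrac_quotLaw_le {n : ℕ} {p : ℝ} (hp : p ∈ Set.Icc (0 : ℝ) 1) (t : ℕ) :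
    ∫ D : Cube n, negFrac D ∂quotLaw n p t ≤ p ^ ((1 / 2 : ℝ) ^ t) := by
  induction t with
  | zero =>
    rw [pow_zero, Real.rpow_one]
    exact integral_negFrac_le hp
  | succ t ih =>
    calc ∫ D : Cube n, negFrac D ∂quotLaw n p (t + 1)
        ≤ ∫ D, sepProb (negFrac D) ∂quotLaw n p t := by
          rw [integral_quotLaw_succ]
          exact integral_mono Integrable.of_finite Integrable.of_finite fun D =>
            integral_negFrac_le (sepProb_mem_Icc _)
      _ ≤ √(p ^ ((1 / 2 : ℝ) ^ t)) :=
          (integral_sepProb_quotLaw_le_sqrt hp t).trans (Real.sqrt_le_sqrt ih)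
      _ = p ^ ((1 / 2 : ℝ) ^ (t + 1)) := sqrt_rpow_half_pow hp.1 t

theorem integral_disagreeProb_netLaw_le {n : ℕ} {h : BoolFun n} {a C : ℝ} (hC : 0 ≤ C)
    (hh : ∀ q ∈ Set.Icc (0 : ℝ) 1, disagreeProb h q ≤ a + C * q) {p : ℝ}
    (hp : p ∈ Set.Icc (0 : ℝ) 1) (T : ℕ) :
    ∫ f, disagreeProb f p ∂netLaw T h ≤ a + C * p ^ ((1 / 2 : ℝ) ^ T) := by
  cases T with
  | zero => simpa only [integral_disagreeProb_netLaw_zero, pow_zero, Real.rpow_one] using hh p hp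
  | succ t =>
    have := isProbabilityMeasure_quotLaw n hp t
    calc ∫ f, disagreeProb f p ∂netLaw (t + 1) h
        ≤ ∫ D, (a + C * sepProb (negFrac D)) ∂quotLaw n p t := by
          rw [integral_disagreeProb_netLaw_succ]
          exact integral_mono Integrable.of_finite Integrable.of_finite fun D =>
            hh _ (sepProb_mem_Icc _)
      _ = a + C * ∫ D, sepProb (negFrac D) ∂quotLaw n p t := by
          rw [integral_add Integrable.of_finite Integrable.of_finite, integral_const_mul,
            integral_const, probReal_univ, one_smul]
      _ ≤ a + C * p ^ ((1 / 2 : ℝ) ^ (t + 1)) := by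
          rw [← sqrt_rpow_half_pow hp.1]
          gcongr
          exact (integral_sepProb_quotLaw_le_sqrt hp t).trans
            (Real.sqrt_le_sqrt (integral_negFrac_quotLaw_le hp t))

theorem exists_disagreeProb_le_of_noiseStable {h : ∀ n, BoolFun n} (hh : NoiseStable h) {δ : ℝ}
    (hδ : 0 < δ) :
    ∃ C, 0 ≤ C ∧ ∀ n, ∀ p ∈ Set.Icc (0 : ℝ) 1, disagreeProb (h n) p ≤ δ + C * p := by
  obtain ⟨η, hη, hsub⟩ := mem_nhdsGT_iff_exists_Ioo_subset.1 <|
    ENNReal.tendsto_nhds_zero.1 hh (ENNReal.ofReal δ) (ENNReal.ofReal_pos.2 hδ)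
  have hη0 : 0 < η := hη
  refine ⟨1 / η, by positivity, fun n p hp => ?_⟩
  have := isProbabilityMeasure_noisePair n hp
  have hslope : 0 ≤ 1 / η * p := mul_nonneg (by positivity) hp.1
  rcases hp.1.eq_or_lt with rfl | hp0
  · rw [disagreeProb_zero]
    positivity
  rcases lt_or_ge p η with hlt | hge
  · have hle : disagreeProb (h n) p ≤ δ := ENNReal.toReal_le_of_le_ofReal hδ.le <|
      (le_iSup (fun n => noisePair n p {q | h n q.1 ≠ h n q.2}) n).trans (hsub ⟨hp0, hlt⟩)
    linarith
  · calc disagreeProb (h n) p ≤ 1 := measureReal_le_one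
      _ ≤ 1 / η * p := by rwa [one_div_mul_eq_div, one_le_div hη0]
      _ ≤ δ + 1 / η * p := le_add_of_nonneg_left hδ.le

theorem eventually_integral_disagreeProb_netLaw_le {T : ℕ → ℕ} {B : ℕ} (hT : ∀ n, T n ≤ B)
    {h : ∀ n, BoolFun n} (hh : NoiseStable h) {δ : ℝ} (hδ : 0 < δ) :
    ∀ᶠ p in 𝓝[>] 0, ∀ n, ∫ f, disagreeProb f p ∂netLaw (T n) (h n) ≤ δ := by
  obtain ⟨C, hC, hlin⟩ := exists_disagreeProb_le_of_noiseStable hh (half_pos hδ)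
  have hlim : Tendsto (fun p : ℝ => C * p ^ ((1 / 2 : ℝ) ^ B)) (𝓝[>] 0) (𝓝 0) := by
    have hcont : Continuous fun p : ℝ => C * p ^ ((1 / 2 : ℝ) ^ B) :=
      continuous_const.mul (Real.continuous_rpow_const (by positivity))
    exact (hcont.tendsto' 0 0 (by rw [Real.zero_rpow (by positivity), mul_zero])).mono_left
      nhdsWithin_le_nhds
  filter_upwards [hlim.eventually_le_const (half_pos hδ), Ioo_mem_nhdsGT one_pos]
    with p hsmall hp n
  have hp' : p ∈ Set.Icc (0 : ℝ) 1 := Set.Ioo_subset_Icc_self hp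
  calc ∫ f, disagreeProb f p ∂netLaw (T n) (h n)
      ≤ δ / 2 + C * p ^ ((1 / 2 : ℝ) ^ T n) := integral_disagreeProb_netLaw_le hC (hlin n) hp' _
    _ ≤ δ / 2 + C * p ^ ((1 / 2 : ℝ) ^ B) := by
        gcongr _ + _ * ?_
        exact Real.rpow_le_rpow_of_exponent_ge hp.1 hp'.2
          (pow_le_pow_of_le_one one_half_pos.le one_half_lt_one.le (hT n))
    _ ≤ δ := by linarith

theorem prod_noisePair_ne {n : ℕ} (π : Measure (BoolFun n)) [IsFiniteMeasure π] (p : ℝ) :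
    (π.prod (noisePair n p)) {q | q.1 q.2.1 ≠ q.1 q.2.2} =
      ENNReal.ofReal (∫ f, disagreeProb f p ∂π) := by
  have hnonneg : 0 ≤ᵐ[π] fun f => disagreeProb f p :=
    Eventually.of_forall fun f => measureReal_nonneg
  rw [Measure.prod_apply (Set.toFinite _).measurableSet,
    ofReal_integral_eq_lintegral_ofReal Integrable.of_finite hnonneg]
  exact lintegral_congr fun f => (ofReal_measureReal (measure_ne_top _ _)).symm

theorem annealedNoiseStable_netLaw {T : ℕ → ℕ} {B : ℕ} (hT : ∀ n, T n ≤ B)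
    {h : ∀ n, BoolFun n} (hh : NoiseStable h) :
    AnnealedNoiseStable fun n => netLaw (T n) (h n) := by
  refine ENNReal.tendsto_nhds_zero.2 fun e he => ?_
  obtain ⟨δ, hδ, hδe⟩ := ENNReal.lt_iff_exists_nnreal_btwn.1 he
  filter_upwards [eventually_integral_disagreeProb_netLaw_le hT hh
    (NNReal.coe_pos.2 (ENNReal.coe_pos.1 hδ))] with p hp
  refine iSup_le fun n => ?_
  rw [prod_noisePair_ne]
  exact (ENNReal.ofReal_le_of_le_toReal (hp n)).trans hδe.le

theorem quenchedNoiseStable_netLaw {T : ℕ → ℕ} {B : ℕ} (hT : ∀ n, T n ≤ B)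
    {h : ∀ n, BoolFun n} (hh : NoiseStable h) :
    QuenchedNoiseStable fun n => netLaw (T n) (h n) := by
  intro δ hδ
  obtain ⟨p, hmean, hp⟩ := ((eventually_integral_disagreeProb_netLaw_le hT hh
    (mul_pos hδ hδ)).and (Ioo_mem_nhdsGT (by norm_num : (0 : ℝ) < 1 / 2))).exists
  exact ⟨p, hp.1, hp.2.le, fun n => one_sub_le_measureReal_lt (measurable_of_countable _)
    Integrable.of_finite (fun f => measureReal_nonneg) hδ (hmean n)⟩

end SignNetwork

end

theorem mainTheorem2_general :
    (∀ (ε K : ℕ → ℝ), (∀ n, ε n ≤ 1 / 2) →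
      Tendsto (fun n : ℕ => (n : ℝ) * ε n) atTop atTop →
      Tendsto (fun n : ℕ => K n / Real.log (1 / ε n)) atTop atTop →
      (∀ (T : ℕ → ℕ) (h : ∀ n, BoolFun n),
        (∀ᶠ n : ℕ in atTop, K n ≤ (T n : ℝ) ∧ (T n : ℝ) ≤ Real.exp (n / 200)) →
        AnnealedQNS (fun n => netLaw (T n) (h n)) ε) ∧
      (∀ (T : ℕ → ℕ) (h : ∀ n, BoolFun n),
        (∀ n, 1 ≤ n → ∀ ω, h n (-ω) = -h n ω) → (∀ᶠ n : ℕ in atTop, K n ≤ (T n : ℝ)) →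
        AnnealedQNS (fun n => netLaw (T n) (h n)) ε) ∧
      (∀ (T : ℕ → ℕ) (h : ∀ n, BoolFun n), (∀ᶠ n : ℕ in atTop, K n ≤ (T n : ℝ)) →
        QuenchedQNS (fun n => netLaw (T n) (h n)) ε)) ∧
    (∃ (h : ∀ n, BoolFun n) (τ : ℕ → ℕ), ∀ T : ℕ → ℕ, (∀ᶠ n : ℕ in atTop, τ n ≤ T n) →
      ¬ AnnealedNoiseSensitive (fun n => netLaw (T n) (h n))) ∧
    (∀ (T : ℕ → ℕ) (h : ∀ n, BoolFun n), (∃ B, ∀ n, T n ≤ B) → NoiseStable h →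
      AnnealedNoiseStable (fun n => netLaw (T n) (h n)) ∧
      QuenchedNoiseStable (fun n => netLaw (T n) (h n))) :=
  ⟨fun _ _ hε hn hK =>
      ⟨fun _ h hT => annealedQNS_of_le_exp hε hn hK hT h,
        fun _ _ hodd hT => annealedQNS_of_odd hε hn hK hT hodd,
        fun _ h hT => quenchedQNS_netLaw hε hn hK hT h⟩,
    exists_not_annealedNoiseSensitive,
    fun _ _ ⟨_, hT⟩ hh => ⟨annealedNoiseStable_netLaw hT hh, quenchedNoiseStable_netLaw hT hh⟩⟩

theorem mainTheorem2 :
    (∀ (ε K : ℕ → ℝ), (∀ n, ε n ≤ 1 / 2) → Antitone ε → Tendsto ε atTop (𝓝 0) →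
      Tendsto (fun n : ℕ => (n : ℝ) * ε n) atTop atTop →
      Tendsto (fun n : ℕ => K n / Real.log (1 / ε n)) atTop atTop →
      -- moderate depth, arbitrary output functions
      (∀ (b : ℕ → ℝ) (T : ℕ → ℕ) (h : ∀ n, BoolFun n),
        Tendsto b atTop (𝓝 0) → Tendsto (fun n : ℕ => (n : ℝ) * b n) atTop atTop →
        (∀ᶠ n : ℕ in atTop, K n ≤ (T n : ℝ) ∧ (T n : ℝ) ≤ Real.exp (b n * n)) →
        AnnealedQNS (fun n => netLaw (T n) (h n)) ε) ∧
      -- large depth, odd output functions (there are none for `n = 0`)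
      (∀ (T : ℕ → ℕ) (h : ∀ n, BoolFun n),
        (∀ n, 1 ≤ n → ∀ ω, h n (-ω) = -h n ω) → (∀ᶠ n : ℕ in atTop, K n ≤ (T n : ℝ)) →
        AnnealedQNS (fun n => netLaw (T n) (h n)) ε) ∧
      -- large depth, arbitrary output functions, quenched
      (∀ (T : ℕ → ℕ) (h : ∀ n, BoolFun n), (∀ᶠ n : ℕ in atTop, K n ≤ (T n : ℝ)) →
        QuenchedQNS (fun n => netLaw (T n) (h n)) ε)) ∧
    -- failure of annealed sensitivity for sufficiently fast growing depth
    (∃ (h : ∀ n, BoolFun n) (τ : ℕ → ℕ), ∀ T : ℕ → ℕ, (∀ᶠ n : ℕ in atTop, τ n ≤ T n) →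
      ¬ AnnealedNoiseSensitive (fun n => netLaw (T n) (h n))) ∧
    -- bounded depth, noise stable output functions
    (∀ (T : ℕ → ℕ) (h : ∀ n, BoolFun n), (∃ B, ∀ n, T n ≤ B) → NoiseStable h →
      AnnealedNoiseStable (fun n => netLaw (T n) (h n)) ∧
      QuenchedNoiseStable (fun n => netLaw (T n) (h n))) := by
  refine ⟨fun ε K hε _ _ hn hK => ?_, mainTheorem2_general.2⟩
  obtain ⟨hmoderate, hlarge⟩ := mainTheorem2_general.1 ε K hε hn hK
  refine ⟨fun b T h hb _ hT => hmoderate T h ?_, hlarge⟩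
  filter_upwards [hT, hb.eventually_le_const (by norm_num : (0 : ℝ) < 1 / 200)] with n hT hb
  refine ⟨hT.1, hT.2.trans (Real.exp_le_exp.2 ?_)⟩
  calc b n * n ≤ 1 / 200 * n := by gcongr
    _ = n / 200 := by ring
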